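/- For a finite simple undirected graph $G=(V,E)$, let $$\mathrm{vi}(G)=\min_{S\subseteq V}\Bigl(|S|+\max_{C\in\mathrm{cc}(G-S)}|V(C)|\Bigr)$$ be its vertex integrity, where $\mathrm{cc}(G-S)$ is the set of connected components of $G-S$ and the maximum over the empty set is $0$. Let $\mathrm{cvd}(G)$ be the cluster vertex deletion number of $G$, that is, the minimum size of a set $D\subseteq V$ such that $G-D$ is a disjoint union of complete graphs. Unweighted Vertex Integrity is the problem of deciding, for a given graph $G$ and a given non-negative integer $\ell$, whether $\mathrm{vi}(G)\le \ell$. **Theorem.** Unweighted Vertex Integrity is fixed-parameter tractable parameterized by the cluster vertex deletion number. That is, there are an algorithm, a computable function $f\colon\mathbb{N}\to\mathbb{N}$ and a constant $c$ such that, given any graph $G$ on $n\ge 0$ vertices (by its adjacency matrix) and any integer $\ell\ge 0$, the algorithm decides correctly whether $\mathrm{vi}(G)\le\ell$ in at most $f(\mathrm{cvd}(G))\cdot(n+1)^{c}$ steps. Here the algorithm is a program of a unit-cost random access machine whose operations are constants, addition, truncated subtraction, halving, indirect load and store, and tests for zero; neither $\mathrm{cvd}(G)$ nor a cluster vertex deletion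 set is part of the input. -/

import Mathlib

/-! ### Vertex integrity and cluster vertex deletion number -/

namespace SimpleGraph

/-- The maximum number of vertices of a connected component of `G - S`
(it is `0` if `S` contains all vertices). -/
noncomputable def maxComponentSize {V : Type*} [Fintype V] (G : SimpleGraph V)
    (S : Finset V) : ℕ :=
  ⨆ C : (G.induce ((S : Set V)ᶜ)).ConnectedComponent, C.supp.ncard

/-- The (unweighted) vertex integrity `vi(G) = min_S (|S| + max_{C ∈ cc(G - S)} |V(C)|)`. -/
noncomputable def vertexIntegrity {V : Type*} [Fintype V] (G : SimpleGraph V) : ℕ :=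
  ⨅ S : Finset V, (S.card + G.maxComponentSize S)

/-- `G` is a disjoint union of complete graphs: any two distinct vertices of the same
connected component are adjacent. -/
def IsClusterGraph {V : Type*} (G : SimpleGraph V) : Prop :=
  ∀ u v : V, G.Reachable u v → u ≠ v → G.Adj u v

/-- `D` is a cluster vertex deletion set of `G`: the graph `G - D` is a disjoint union of
complete graphs. -/
def IsClusterVertexDeletionSet {V : Type*} (G : SimpleGraph V) (D : Finset V) : Prop :=
  (G.induce ((D : Set V)ᶜ)).IsClusterGraph

/-- The cluster vertex deletion number `cvd(G)`: the minimum size of a cluster vertex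
deletion set. (The set of all vertices is one, so the minimum exists.) -/
noncomputable def clusterVertexDeletionNumber {V : Type*} [Fintype V]
    (G : SimpleGraph V) : ℕ :=
  sInf {k : ℕ | ∃ D : Finset V, G.IsClusterVertexDeletionSet D ∧ D.card = k}

end SimpleGraph

/-! ### Random access machines

A random access machine with registers `reg 0, reg 1, …` and memory cells `mem 0, mem 1, …`,
each holding a natural number. A program is a fixed finite text, so it uses only finitely many
registers; the memory is addressed indirectly. The elementary operations are those of the usual
unit-cost model: constants, addition, (truncated) subtraction, halving, load and store, and tests
for zero. There is no unit-cost multiplication, so that the model is polynomially equivalent to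
Turing machines. Programs are written with structured control flow. -/

namespace RAM

structure State where
  reg : ℕ → ℕ
  mem : ℕ → ℕ

def State.setReg (s : State) (x a : ℕ) : State := { s with reg := Function.update s.reg x a }

def State.setMem (s : State) (i a : ℕ) : State := { s with mem := Function.update s.mem i a }

inductive Program : Type
  /-- do nothing -/
  | skip : Program
  /-- `reg x := c` -/
  | const (x c : ℕ) : Program
  /-- `reg x := reg y + reg z` -/
  | add (x y z : ℕ) : Program
  /-- `reg x := reg y - reg z` (which is `0` if `reg y < reg z`) -/
  | sub (x y z : ℕ) : Program
  /-- `reg x := ⌊reg y / 2⌋` -/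
  | half (x y : ℕ) : Program
  /-- `reg x := mem (reg y)` -/
  | load (x y : ℕ) : Program
  /-- `mem (reg x) := reg y` -/
  | store (x y : ℕ) : Program
  /-- first `p`, then `q` -/
  | seq (p q : Program) : Program
  /-- if `reg x ≠ 0` then `p` else `q` -/
  | branch (x : ℕ) (p q : Program) : Program
  /-- while `reg x ≠ 0` do `p` -/
  | loop (x : ℕ) (p : Program) : Program

/-- `Exec p s t s'`: the program `p`, started in state `s`, halts in state `s'` after exactly `t`
steps, where each elementary operation and each test of a register costs one step. -/
inductive Exec : Program → State → ℕ → State → Prop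
  | skip (s : State) : Exec .skip s 1 s
  | const (x c : ℕ) (s : State) : Exec (.const x c) s 1 (s.setReg x c)
  | add (x y z : ℕ) (s : State) : Exec (.add x y z) s 1 (s.setReg x (s.reg y + s.reg z))
  | sub (x y z : ℕ) (s : State) : Exec (.sub x y z) s 1 (s.setReg x (s.reg y - s.reg z))
  | half (x y : ℕ) (s : State) : Exec (.half x y) s 1 (s.setReg x (s.reg y / 2))
  | load (x y : ℕ) (s : State) : Exec (.load x y) s 1 (s.setReg x (s.mem (s.reg y)))
  | store (x y : ℕ) (s : State) : Exec (.store x y) s 1 (s.setMem (s.reg x) (s.reg y))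
  | seq {p q : Program} {s s' s'' : State} {t t' : ℕ} :
      Exec p s t s' → Exec q s' t' s'' → Exec (.seq p q) s (t + t') s''
  | branch_true {x : ℕ} {p q : Program} {s s' : State} {t : ℕ} :
      s.reg x ≠ 0 → Exec p s t s' → Exec (.branch x p q) s (t + 1) s'
  | branch_false {x : ℕ} {p q : Program} {s s' : State} {t : ℕ} :
      s.reg x = 0 → Exec q s t s' → Exec (.branch x p q) s (t + 1) s'
  | loop_done {x : ℕ} {p : Program} {s : State} :
      s.reg x = 0 → Exec (.loop x p) s 1 s
  | loop_step {x : ℕ} {p : Program} {s s' s'' : State} {t t' : ℕ} :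
      s.reg x ≠ 0 → Exec p s t s' → Exec (.loop x p) s' t' s'' →
      Exec (.loop x p) s (t + t' + 1) s''

/-- The machine is deterministic: running time and final state are determined by the program and
the initial state. -/
theorem Exec.deterministic {p : Program} {s s₁ s₂ : State} {t₁ t₂ : ℕ}
    (h₁ : Exec p s t₁ s₁) (h₂ : Exec p s t₂ s₂) : t₁ = t₂ ∧ s₁ = s₂ := by
  induction h₁ generalizing t₂ s₂ with
  | seq _ _ ih ih' =>
    cases h₂ with
    | seq a b =>
      obtain ⟨rfl, rfl⟩ := ih a
      obtain ⟨rfl, rfl⟩ := ih' b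
      exact ⟨rfl, rfl⟩
  | branch_true h _ ih =>
    cases h₂ with
    | branch_true _ a => obtain ⟨rfl, rfl⟩ := ih a; exact ⟨rfl, rfl⟩
    | branch_false h' _ => exact absurd h' h
  | branch_false h _ ih =>
    cases h₂ with
    | branch_true h' _ => exact absurd h h'
    | branch_false _ a => obtain ⟨rfl, rfl⟩ := ih a; exact ⟨rfl, rfl⟩
  | loop_done h =>
    cases h₂ with
    | loop_done _ => exact ⟨rfl, rfl⟩
    | loop_step h' _ _ => exact absurd h h'
  | loop_step h _ _ ih ih' =>
    cases h₂ with
    | loop_done h' => exact absurd h' h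
    | loop_step _ a b =>
      obtain ⟨rfl, rfl⟩ := ih a
      obtain ⟨rfl, rfl⟩ := ih' b
      exact ⟨rfl, rfl⟩
  | _ => cases h₂; exact ⟨rfl, rfl⟩

end RAM

/-- Fixed-parameter tractability of a decision problem. The instances form a type `I`; the
instance `x` is presented to the machine as the initial state `input x`, has size `size x` and
parameter `param x`, and is a yes-instance if `yes x`. There are one program, one computable
function `f` and one exponent `c` such that on every instance the program halts within
`f (param x) * (size x + 1) ^ c` steps and accepts (halts with a non-zero number in register `0`)
exactly the yes-instances. The parameter is not part of the input. -/
def FixedParameterTractable {I : Type*} (input : I → RAM.State) (size param : I → ℕ)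
    (yes : I → Prop) : Prop :=
  ∃ (p : RAM.Program) (f : ℕ → ℕ) (c : ℕ), Computable f ∧
    ∀ x : I, ∃ (t : ℕ) (s : RAM.State), RAM.Exec p (input x) t s ∧
      t ≤ f (param x) * (size x + 1) ^ c ∧ (s.reg 0 ≠ 0 ↔ yes x)

/-! ### The problem -/

/-- An instance of Unweighted Vertex Integrity: a graph `G` on the vertices `0, …, n - 1` and a
non-negative integer `bound`; the question is whether `vi(G) ≤ bound`. -/
structure VertexIntegrityInstance where
  n : ℕ
  graph : SimpleGraph (Fin n)
  bound : ℕ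

open scoped Classical in
/-- The initial state for an instance: `reg 0 = n`, `reg 1 = bound`, and the adjacency matrix of
the graph row by row in the memory cells `0, …, n * n - 1`; everything else is `0`. -/
noncomputable def VertexIntegrityInstance.input (x : VertexIntegrityInstance) : RAM.State where
  reg r := if r = 0 then x.n else if r = 1 then x.bound else 0
  mem a := if ∃ i j : Fin x.n, x.graph.Adj i j ∧ a = (i : ℕ) * x.n + (j : ℕ) then 1 else 0

/-!
# Vertex integrity is fixed-parameter tractable by the cluster vertex deletion number

Fix a threshold `m`; a largest set `K` of vertices is sought such that the components of the graph
induced on `K` have at most `m` vertices. Let `D` be the vertex set of a maximal packing of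
induced paths on three vertices (`modulator`). Every cluster vertex deletion set meets every such
path, so that `d = |D|` is at most three times the parameter (`dNum_le_three_mul`), and the graph
without `D` is a disjoint union of cliques (`adj_trans`).

The algorithm guesses the partition of `D` into deleted vertices and into blocks, the traces of
the components on `D`; this is a labelling of `D` with the numbers `0, …, d`. The vertices that
are kept in one clique lie in one component, so each clique joins a block, in which case its
vertices with neighbours in other blocks are deleted, or is separated from all blocks. Some cliques
can be kept unreduced (to `m` vertices, if they are larger) by joining a certain block or by being
separated. For them only that block and separation are relevant options, since
with respect to any other block only the vertices without kept neighbours in `D` are available.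
Every other clique falls short of `min (size) m` kept vertices whatever it does. As one may delete
all of `D` and keep `min (size) m` vertices of every clique, there are at most `d` cliques of
the latter kind for an optimal `K`, and their blocks are guessed as well (`exists_guess`). Once the
guess is fixed the blocks are independent: which of the cliques assigned to a block are separated
from it is a knapsack problem with weights at most `n` (`knap`), solved by dynamic
programming (`get_table`). Conversely, the value of every guess is attained by some set `K`
(`exists_cert_of_guess`). A guess consists of two sequences of `d` numbers less than `2 ^ d`, which
gives `(2 ^ (d * d)) ^ 2` guesses.

No program is written out. `Cmp f` says that `f` is evaluated by programs in time polynomial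
in `n` and in the number of guesses; it is closed under composition, case distinction and loops of
admissible length (`Cmp.iter`), and the memory is only read: arrays are encoded by numbers. The
algorithm is a function in this class (`cmp_accept`).
-/

/-! ### Functions evaluated by the machine in polynomial time -/

namespace RAM

/-- A way to hold the elements of `X` in a machine state. `Pos` is the type of possible places
(tuples of registers), `Below p b` says that the place `p` uses only registers below `b`, and
`Rep x p s` that the state `s` holds `x` at `p`. The number `size x` bounds the lengths of the
loops that a computation on `x` may run. -/
class Layout (X : Type) where
  Pos : Type
  Below : Pos → ℕ → Prop
  Rep : X → Pos → State → Prop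
  size : X → ℕ
  below_mono : ∀ {p : Pos} {b b' : ℕ}, Below p b → b ≤ b' → Below p b'
  rep_congr : ∀ {x : X} {p : Pos} {b : ℕ} {s s' : State}, Below p b → Rep x p s →
    (∀ i < b, s'.reg i = s.reg i) → s'.mem = s.mem → Rep x p s'

open Layout

instance : Layout ℕ where
  Pos := ℕ
  Below p b := p < b
  Rep x p s := s.reg p = x
  size _ := 0
  below_mono h h' := lt_of_lt_of_le h h'
  rep_congr h hr he _ := (he _ h).trans hr

/-- A truth value is held as a number that is non-zero iff the proposition holds. -/
instance : Layout Prop where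
  Pos := ℕ
  Below p b := p < b
  Rep x p s := s.reg p ≠ 0 ↔ x
  size _ := 0
  below_mono h h' := lt_of_lt_of_le h h'
  rep_congr h hr he _ := by rw [he _ h]; exact hr

instance {X Y : Type} [Layout X] [Layout Y] : Layout (X × Y) where
  Pos := Pos X × Pos Y
  Below p b := Below p.1 b ∧ Below p.2 b
  Rep x p s := Rep x.1 p.1 s ∧ Rep x.2 p.2 s
  size x := max (size x.1) (size x.2)
  below_mono h h' := ⟨below_mono h.1 h', below_mono h.2 h'⟩
  rep_congr h hr he hm := ⟨rep_congr h.1 hr.1 he hm, rep_congr h.2 hr.2 he hm⟩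

/-- `f : X → Y` is evaluated by machine programs in time polynomial in the size: wherever the
argument lies, below a register `b`, a program that leaves the memory and the registers below `b`
alone produces the value somewhere from `b` on. The base `size x + 2` is at least `2`, so that
constant factors are absorbed by the exponent. -/
@[fun_prop]
def Cmp {X Y : Type} [Layout X] [Layout Y] (f : X → Y) : Prop :=
  (∀ x, size (f x) ≤ size x) ∧
  ∃ (p : Pos X → ℕ → Program) (q : Pos X → ℕ → Pos Y) (e : Pos X → ℕ → ℕ) (c : ℕ),
    ∀ pos b, Below pos b → b ≤ e pos b ∧ Below (q pos b) (e pos b) ∧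
      ∀ x s, Rep x pos s → ∃ t s', Exec (p pos b) s t s' ∧ Rep (f x) (q pos b) s' ∧
        (∀ i < b, s'.reg i = s.reg i) ∧ s'.mem = s.mem ∧ t ≤ (size x + 2) ^ c

variable {X Y Z : Type} [Layout X] [Layout Y] [Layout Z]

theorem pow_add_pow_le (a c d : ℕ) : (a + 2) ^ c + (a + 2) ^ d ≤ (a + 2) ^ (c + d + 1) := by
  have h1 : (a + 2) ^ c ≤ (a + 2) ^ (c + d) := Nat.pow_le_pow_right (by omega) (by omega)
  have h2 : (a + 2) ^ d ≤ (a + 2) ^ (c + d) := Nat.pow_le_pow_right (by omega) (by omega)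
  have h3 := Nat.zero_le ((a + 2) ^ (c + d) * a)
  rw [pow_succ, mul_add]
  omega

theorem lt_add_two_pow (a c : ℕ) : c < (a + 2) ^ c :=
  lt_of_lt_of_le (Nat.lt_two_pow_self) (Nat.pow_le_pow_left (by omega) c)

@[fun_prop]
theorem Cmp.id : Cmp (fun x : X => x) :=
  ⟨fun _ => le_rfl, fun _ _ => .skip, fun pos _ => pos, fun _ b => b, 0, fun _ _ hb =>
    ⟨le_rfl, hb, fun _ s hs => ⟨1, s, .skip s, hs, fun _ _ => rfl, rfl, by simp⟩⟩⟩

@[fun_prop]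
theorem Cmp.comp {g : Y → Z} {f : X → Y} (hg : Cmp g) (hf : Cmp f) :
    Cmp (fun x => g (f x)) := by
  obtain ⟨hs, p, q, e, c, h⟩ := hf
  obtain ⟨hs', p', q', e', c', h'⟩ := hg
  refine ⟨fun x => (hs' _).trans (hs x), fun pos b => .seq (p pos b) (p' (q pos b) (e pos b)),
    fun pos b => q' (q pos b) (e pos b), fun pos b => e' (q pos b) (e pos b), c + c' + 1,
    fun pos b hb => ?_⟩
  obtain ⟨h1, h2, h3⟩ := h pos b hb
  obtain ⟨h1', h2', h3'⟩ := h' _ _ h2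
  refine ⟨h1.trans h1', h2', fun x s hx => ?_⟩
  obtain ⟨t, s', a1, a2, a3, a4, a5⟩ := h3 x s hx
  obtain ⟨t', s'', b1, b2, b3, b4, b5⟩ := h3' _ s' a2
  refine ⟨t + t', s'', a1.seq b1, b2,
    fun i hi => (b3 i (hi.trans_le h1)).trans (a3 i hi), b4.trans a4, ?_⟩
  have : t' ≤ (size x + 2) ^ c' :=
    b5.trans (Nat.pow_le_pow_left (Nat.add_le_add_right (hs x) 2) _)
  exact (Nat.add_le_add a5 this).trans (pow_add_pow_le _ _ _)

@[fun_prop]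
theorem Cmp.fst : Cmp (fun x : X × Y => x.1) :=
  ⟨fun _ => le_max_left _ _, fun _ _ => .skip, fun pos _ => pos.1, fun _ b => b, 0,
    fun _ _ hb => ⟨le_rfl, hb.1, fun _ s hs =>
      ⟨1, s, .skip s, hs.1, fun _ _ => rfl, rfl, by simp⟩⟩⟩

@[fun_prop]
theorem Cmp.snd : Cmp (fun x : X × Y => x.2) :=
  ⟨fun _ => le_max_right _ _, fun _ _ => .skip, fun pos _ => pos.2, fun _ b => b, 0,
    fun _ _ hb => ⟨le_rfl, hb.2, fun _ s hs =>
      ⟨1, s, .skip s, hs.2, fun _ _ => rfl, rfl, by simp⟩⟩⟩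

@[fun_prop]
theorem Cmp.prodMk {f : X → Y} {g : X → Z} (hf : Cmp f) (hg : Cmp g) :
    Cmp (fun x => (f x, g x)) := by
  obtain ⟨hs, p, q, e, c, h⟩ := hf
  obtain ⟨hs', p', q', e', c', h'⟩ := hg
  refine ⟨fun x => max_le (hs x) (hs' x), fun pos b => .seq (p pos b) (p' pos (e pos b)),
    fun pos b => (q pos b, q' pos (e pos b)), fun pos b => e' pos (e pos b), c + c' + 1,
    fun pos b hb => ?_⟩
  obtain ⟨h1, h2, h3⟩ := h pos b hb
  obtain ⟨h1', h2', h3'⟩ := h' pos _ (below_mono hb h1)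
  refine ⟨h1.trans h1', ⟨below_mono h2 h1', h2'⟩, fun x s hx => ?_⟩
  obtain ⟨t, s', a1, a2, a3, a4, a5⟩ := h3 x s hx
  obtain ⟨t', s'', b1, b2, b3, b4, b5⟩ := h3' x s' (rep_congr hb hx a3 a4)
  exact ⟨t + t', s'', a1.seq b1, ⟨rep_congr h2 a2 b3 b4, b2⟩,
    fun i hi => (b3 i (hi.trans_le h1)).trans (a3 i hi), b4.trans a4,
    (Nat.add_le_add a5 b5).trans (pow_add_pow_le _ _ _)⟩

/-- A function of the registers' contents that is evaluated by one elementary operation. -/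
theorem Cmp.of_instr {f : X → ℕ} (i : Pos X → ℕ → Program)
    (h : ∀ pos b, Below pos b → ∀ x s, Rep x pos s → Exec (i pos b) s 1 (s.setReg b (f x))) :
    Cmp f := by
  refine ⟨fun _ => Nat.zero_le _, i, fun _ b => b, fun _ b => b + 1, 0, fun pos b hb =>
    ⟨Nat.le_succ b, Nat.lt_succ_self b, fun x s hx =>
      ⟨1, _, h pos b hb x s hx, ?_, ?_, rfl, by simp⟩⟩⟩
  · exact Function.update_self ..
  · intro i hi
    exact Function.update_of_ne (by omega) _ _

@[fun_prop]
theorem Cmp.const (c : ℕ) : Cmp (fun _ : X => c) :=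
  Cmp.of_instr (fun _ b => .const b c) fun _ b _ _ s _ => .const b c s

@[fun_prop]
theorem Cmp.add {f g : X → ℕ} (hf : Cmp f) (hg : Cmp g) : Cmp (fun x => f x + g x) :=
  Cmp.comp (g := fun y : ℕ × ℕ => y.1 + y.2)
    (Cmp.of_instr (fun pos b => .add b pos.1 pos.2) fun pos b _ y s hy => by
      rw [← (show s.reg pos.1 = y.1 from hy.1), ← (show s.reg pos.2 = y.2 from hy.2)]
      exact .add _ _ _ s) (hf.prodMk hg)

@[fun_prop]
theorem Cmp.sub {f g : X → ℕ} (hf : Cmp f) (hg : Cmp g) : Cmp (fun x => f x - g x) :=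
  Cmp.comp (g := fun y : ℕ × ℕ => y.1 - y.2)
    (Cmp.of_instr (fun pos b => .sub b pos.1 pos.2) fun pos b _ y s hy => by
      rw [← (show s.reg pos.1 = y.1 from hy.1), ← (show s.reg pos.2 = y.2 from hy.2)]
      exact .sub _ _ _ s) (hf.prodMk hg)

/-- Halving. -/
def hlf (a : ℕ) : ℕ := a / 2

@[fun_prop]
theorem Cmp.hlf {f : X → ℕ} (hf : Cmp f) : Cmp (fun x => hlf (f x)) :=
  Cmp.comp (g := RAM.hlf)
    (Cmp.of_instr (fun pos b => .half b pos) fun pos b _ y s hy => by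
      rw [← (show s.reg pos = y from hy)]
      exact .half _ _ s) hf

@[fun_prop]
theorem Cmp.ne_zero {f : X → ℕ} (hf : Cmp f) : Cmp (fun x => f x ≠ 0) := by
  refine Cmp.comp (g := fun y : ℕ => y ≠ 0) ?_ hf
  refine ⟨fun _ => le_rfl, fun _ _ => .skip, fun pos _ => pos, fun _ b => b, 0, fun _ _ hb =>
    ⟨le_rfl, hb, fun y s hs => ⟨1, s, .skip s, ?_, fun _ _ => rfl, rfl, by simp⟩⟩⟩
  change s.reg _ ≠ 0 ↔ y ≠ 0
  rw [show s.reg _ = y from hs]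

@[fun_prop]
theorem Cmp.ite {P : X → Prop} [∀ x, Decidable (P x)] {f g : X → ℕ} (hP : Cmp P) (hf : Cmp f)
    (hg : Cmp g) : Cmp (fun x => if P x then f x else g x) := by
  classical
  have key : Cmp (fun y : Prop × ℕ × ℕ => if y.1 then y.2.1 else y.2.2) := by
    refine ⟨fun _ => Nat.zero_le _, fun pos b => .seq (.const b 0)
      (.branch pos.1 (.add b pos.2.1 b) (.add b pos.2.2 b)), fun _ b => b,
      fun _ b => b + 1, 2, fun pos b hb => ⟨Nat.le_succ b, Nat.lt_succ_self b, fun y s hy => ?_⟩⟩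
    obtain ⟨hb1, hb2, hb3⟩ := hb
    obtain ⟨hy1, hy2, hy3⟩ := hy
    change s.reg pos.1 ≠ 0 ↔ y.1 at hy1
    change s.reg pos.2.1 = y.2.1 at hy2
    change s.reg pos.2.2 = y.2.2 at hy3
    change @LT.lt ℕ _ pos.1 b at hb1
    change @LT.lt ℕ _ pos.2.1 b at hb2
    change @LT.lt ℕ _ pos.2.2 b at hb3
    have e1 : (s.setReg b 0).reg pos.1 = s.reg pos.1 := Function.update_of_ne (ne_of_lt hb1) _ _
    have e2 : (s.setReg b 0).reg pos.2.1 = s.reg pos.2.1 :=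
      Function.update_of_ne (ne_of_lt hb2) _ _
    have e3 : (s.setReg b 0).reg pos.2.2 = s.reg pos.2.2 :=
      Function.update_of_ne (ne_of_lt hb3) _ _
    have e4 : (s.setReg b 0).reg b = 0 := Function.update_self _ _ _
    have ht : 1 + (1 + 1) ≤ (size y + 2) ^ 2 := Nat.succ_le_of_lt (lt_add_two_pow (size y) 2)
    have frame : ∀ a, ∀ i < b, ((s.setReg b 0).setReg b a).reg i = s.reg i := by
      intro a i hi
      simp [State.setReg, Function.update_of_ne (ne_of_lt hi)]
    by_cases h : y.1
    · refine ⟨_, _, .seq (.const b 0 s) (.branch_true (by rw [e1]; exact hy1.2 h) (.add _ _ _ _)),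
        ?_, frame _, rfl, ht⟩
      change ((s.setReg b 0).setReg b _).reg b = if y.1 then y.2.1 else y.2.2
      rw [if_pos h, ← hy2, ← e2, e4]
      exact Function.update_self _ _ _
    · refine ⟨_, _, .seq (.const b 0 s) (.branch_false (by
        rw [e1]; by_contra h'; exact h (hy1.1 h')) (.add _ _ _ _)), ?_, frame _, rfl, ht⟩
      change ((s.setReg b 0).setReg b _).reg b = if y.1 then y.2.1 else y.2.2
      rw [if_neg h, ← hy3, ← e3, e4]
      exact Function.update_self _ _ _
  have := key.comp (hP.prodMk (hf.prodMk hg))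
  refine (congrArg Cmp (funext fun x => ?_)).mp this
  split_ifs <;> simp_all

/-- The result of a loop: `iter k a body` starts from `a` and applies `body 0`, …,
`body (k - 1)`. -/
def iter (k a : ℕ) (body : ℕ → ℕ → ℕ) : ℕ := Nat.rec a (fun i acc => body i acc) k

@[simp] theorem iter_zero (a : ℕ) (body : ℕ → ℕ → ℕ) : iter 0 a body = a := rfl

theorem iter_succ (k a : ℕ) (body : ℕ → ℕ → ℕ) :
    iter (k + 1) a body = body k (iter k a body) := rfl

/-- The definition of `Cmp` for functions with values in `ℕ`, which lie in single registers. -/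
theorem Cmp.exists_program {f : X → ℕ} (h : Cmp f) :
    ∃ (p : Pos X → ℕ → Program) (q e : Pos X → ℕ → ℕ) (c : ℕ),
    ∀ pos b, Below pos b → b ≤ e pos b ∧ q pos b < e pos b ∧
      ∀ x s, Rep x pos s → ∃ t s', Exec (p pos b) s t s' ∧ s'.reg (q pos b) = f x ∧
        (∀ i < b, s'.reg i = s.reg i) ∧ s'.mem = s.mem ∧ t ≤ (size x + 2) ^ c :=
  h.2

/-- A loop is evaluated in polynomial time if its length is at most the size. The accumulator
may become large, but it does not contribute to the size. -/
theorem Cmp.iter {k a : X → ℕ} {body : X → ℕ → ℕ → ℕ} (hle : ∀ x, k x ≤ size x) (hk : Cmp k)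
    (ha : Cmp a) (hb : Cmp (fun y : X × ℕ × ℕ => body y.1 y.2.1 y.2.2)) :
    Cmp (fun x => iter (k x) (a x) (body x)) := by
  obtain ⟨pk, qk, ek, ck, Hk⟩ := hk.exists_program
  obtain ⟨pa, qa, ea, ca, Ha⟩ := ha.exists_program
  obtain ⟨p, q, e, c, H⟩ := hb.exists_program
  -- from register `r` on: the counter, the index, the accumulator and the constants `0` and `1`
  let r : Pos X → ℕ → ℕ := fun pos b => ea pos (ek pos b)
  let P : Pos X → ℕ → Pos (X × ℕ × ℕ) := fun pos b => (pos, r pos b + 1, r pos b + 2)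
  let bodyP : Pos X → ℕ → Program := fun pos b =>
    .seq (p (P pos b) (r pos b + 5))
      (.seq (.add (r pos b + 2) (q (P pos b) (r pos b + 5)) (r pos b + 3))
      (.seq (.add (r pos b + 1) (r pos b + 1) (r pos b + 4))
        (.sub (r pos b) (r pos b) (r pos b + 4))))
  refine ⟨fun _ => Nat.zero_le _, fun pos b => .seq (pk pos b) (.seq (pa pos (ek pos b))
    (.seq (.const (r pos b + 3) 0) (.seq (.const (r pos b + 4) 1) (.seq
      (.add (r pos b) (qk pos b) (r pos b + 3)) (.seq (.const (r pos b + 1) 0)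
      (.seq (.add (r pos b + 2) (qa pos (ek pos b)) (r pos b + 3))
      (.loop (r pos b) (bodyP pos b)))))))),
    fun pos b => r pos b + 2, fun pos b => r pos b + 5, ck + ca + c + 12, fun pos b hb => ?_⟩
  obtain ⟨k1, k2, k3⟩ := Hk pos b hb
  obtain ⟨a1, a2, a3⟩ := Ha pos _ (below_mono hb k1)
  change @LT.lt ℕ _ (qa pos (ek pos b)) (r pos b) at a2
  have hbr : b ≤ r pos b := k1.trans a1
  have hkr : ek pos b ≤ r pos b := a1
  have hPb : Below (P pos b) (r pos b + 5) := by
    refine ⟨below_mono hb (by omega), ?_, ?_⟩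
    · change r pos b + 1 < _; omega
    · change r pos b + 2 < _; omega
  obtain ⟨b1, b2, b3⟩ := H (P pos b) (r pos b + 5) hPb
  refine ⟨hbr.trans (Nat.le_add_right _ _), Nat.add_lt_add_left (by norm_num) _,
    fun x s hx => ?_⟩
  beta_reduce
  generalize hB : bodyP pos b = B
  generalize hr : r pos b = R at *
  have hloop : ∀ (j : ℕ) (s : State), Rep x pos s → s.reg R = j → s.reg R ≤ k x →
      s.reg (R + 1) = k x - j → s.reg (R + 2) = RAM.iter (k x - j) (a x) (body x) →
      s.reg (R + 3) = 0 → s.reg (R + 4) = 1 →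
      ∃ t s', Exec (.loop R B) s t s' ∧ s'.reg (R + 2) = RAM.iter (k x) (a x) (body x) ∧
        (∀ i < b, s'.reg i = s.reg i) ∧ s'.mem = s.mem ∧
        t ≤ j * ((size x + 2) ^ c + 4) + 1 := by
    intro j
    induction j with
    | zero =>
      intro s _ h0 _ _ h2 _ _
      exact ⟨1, s, .loop_done h0, by simpa using h2, fun _ _ => rfl, rfl, by omega⟩
    | succ j ih =>
      intro s hs h0 hj h1 h2 h3 h4
      obtain ⟨t, s1, x1, x2, x3, x4, x5⟩ :=
        b3 (x, k x - (j + 1), RAM.iter (k x - (j + 1)) (a x) (body x)) s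
        ⟨hs, by subst hr; exact h1, by subst hr; exact h2⟩
      have hsz : size (x, k x - (j + 1), RAM.iter (k x - (j + 1)) (a x) (body x)) = size x := by
        change max (size x) (max 0 0) = size x
        simp
      rw [hsz] at x5
      set s2 := s1.setReg (R + 2) (s1.reg (q (P pos b) (R + 5)) + s1.reg (R + 3)) with hs2
      set s3 := s2.setReg (R + 1) (s2.reg (R + 1) + s2.reg (R + 4)) with hs3
      set s4 := s3.setReg R (s3.reg R - s3.reg (R + 4)) with hs4
      have E : Exec B s (t + (1 + (1 + 1))) s4 := by
        rw [← hB]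
        simp only [bodyP, hr]
        exact x1.seq ((Exec.add _ _ _ _).seq ((Exec.add _ _ _ _).seq (Exec.sub _ _ _ _)))
      have f : ∀ i < b, s4.reg i = s.reg i := by
        intro i hi
        simp only [hs4, hs3, hs2, State.setReg]
        rw [Function.update_of_ne (by omega), Function.update_of_ne (by omega),
          Function.update_of_ne (by omega)]
        exact x3 i (by omega)
      have m4 : s4.mem = s.mem := x4
      have g0 := x3 R (by omega)
      have g1 := x3 (R + 1) (by omega)
      have g3 := x3 (R + 3) (by omega)
      have g4 := x3 (R + 4) (by omega)
      have v0 : s4.reg R = j := by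
        simp [hs4, hs3, hs2, State.setReg, g0, g4, h0, h4]
      have v1 : s4.reg (R + 1) = k x - j := by
        simp [hs4, hs3, hs2, State.setReg, g1, g4, h1, h4]
        omega
      have v2 : s4.reg (R + 2) = RAM.iter (k x - j) (a x) (body x) := by
        have : k x - j = k x - (j + 1) + 1 := by omega
        rw [this, iter_succ, ← x2]
        simp [hs4, hs3, hs2, State.setReg, g3, h3]
      have v3 : s4.reg (R + 3) = 0 := by
        simp [hs4, hs3, hs2, State.setReg, g3, h3]
      have v4 : s4.reg (R + 4) = 1 := by
        simp [hs4, hs3, hs2, State.setReg, g4, h4]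
      obtain ⟨t', s', y1, y2, y3, y4, y5⟩ := ih s4 (rep_congr hb hs f m4) v0 (by omega) v1 v2 v3 v4
      refine ⟨_, s', .loop_step (by omega) E y1, y2, fun i hi => (y3 i hi).trans (f i hi),
        y4.trans m4, ?_⟩
      rw [Nat.succ_mul]
      omega
  obtain ⟨tk, sk, x1, x2, x3, x4, x5⟩ := k3 x s hx
  obtain ⟨ta, sa, y1, y2, y3, y4, y5⟩ := a3 x sk (rep_congr hb hx x3 x4)
  have x2' := y3 _ k2
  set s1 := sa.setReg (R + 3) 0 with hs1
  set s2 := s1.setReg (R + 4) 1 with hs2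
  set s3 := s2.setReg R (s2.reg (qk pos b) + s2.reg (R + 3)) with hs3
  set s4 := s3.setReg (R + 1) 0 with hs4
  set s5 := s4.setReg (R + 2) (s4.reg (qa pos (ek pos b)) + s4.reg (R + 3)) with hs5
  have f : ∀ i < b, s5.reg i = s.reg i := by
    intro i hi
    simp only [hs5, hs4, hs3, hs2, hs1, State.setReg]
    rw [Function.update_of_ne (by omega), Function.update_of_ne (by omega),
      Function.update_of_ne (by omega), Function.update_of_ne (by omega),
      Function.update_of_ne (by omega)]
    exact (y3 i (by omega)).trans (x3 i hi)
  have m5 : s5.mem = s.mem := y4.trans x4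
  have n1 : qk pos b ≠ R := by omega
  have n2 : qk pos b ≠ R + 3 := by omega
  have n3 : qk pos b ≠ R + 4 := by omega
  have n4 : qa pos (ek pos b) ≠ R := by omega
  have n5 : qa pos (ek pos b) ≠ R + 3 := by omega
  have n6 : qa pos (ek pos b) ≠ R + 4 := by omega
  have n7 : qa pos (ek pos b) ≠ R + 1 := by omega
  obtain ⟨t, s', z1, z2, z3, z4, z5⟩ := hloop (k x) s5 (rep_congr hb hx f m5)
    (by simp [hs5, hs4, hs3, hs2, hs1, State.setReg, Function.update_apply, n2, n3, x2, x2'])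
    (by simp [hs5, hs4, hs3, hs2, hs1, State.setReg, Function.update_apply, n2, n3, x2, x2'])
    (by simp [hs5, hs4, State.setReg, Function.update_apply])
    (by simp [hs5, hs4, hs3, hs2, hs1, State.setReg, Function.update_apply, n4, n5, n6, n7, y2])
    (by simp [hs5, hs4, hs3, hs2, hs1, State.setReg, Function.update_apply])
    (by simp [hs5, hs4, hs3, hs2, hs1, State.setReg, Function.update_apply])
  refine ⟨_, s', x1.seq (y1.seq ((Exec.const _ _ _).seq ((Exec.const _ _ _).seq
    ((Exec.add _ _ _ _).seq ((Exec.const _ _ _).seq ((Exec.add _ _ _ _).seq z1)))))), z2,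
    fun i hi => (z3 i hi).trans (f i hi), z4.trans m5, ?_⟩
  have hK := hle x
  have T1 : k x * ((size x + 2) ^ c + 4) ≤ (size x + 2) ^ (c + 4) := by
    have h8 : 8 ≤ (size x + 2) ^ 3 :=
      le_trans (by norm_num) (Nat.pow_le_pow_left (show 2 ≤ size x + 2 by omega) 3)
    have hc : 1 ≤ (size x + 2) ^ c := Nat.one_le_pow _ _ (by omega)
    have e1 : (size x + 2) ^ (c + 4) = (size x + 2) * ((size x + 2) ^ c * (size x + 2) ^ 3) := by
      ring
    rw [e1]
    apply Nat.mul_le_mul (by omega)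
    nlinarith
  have T2 := pow_add_pow_le (size x) ck ca
  have T3 := pow_add_pow_le (size x) (ck + ca + 1) (c + 4)
  have T4 := pow_add_pow_le (size x) (ck + ca + 1 + (c + 4) + 1) 4
  have h16 : 16 ≤ (size x + 2) ^ 4 :=
    le_trans (by norm_num) (Nat.pow_le_pow_left (show 2 ≤ size x + 2 by omega) 4)
  have T6 : (size x + 2) ^ (ck + ca + 1 + (c + 4) + 1 + 4 + 1) ≤
      (size x + 2) ^ (ck + ca + c + 12) :=
    Nat.pow_le_pow_right (by omega) (by omega)
  omega

end RAM

namespace RAM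
open Layout

variable {X : Type} [Layout X]

/-! ### Derived operations -/

/-- `k` is evaluated by the machine and admissible as the length of a loop. -/
@[fun_prop]
def CmpLength (k : X → ℕ) : Prop := Cmp k ∧ ∀ x, k x ≤ size x

@[fun_prop]
theorem Cmp.iter_of_length {k a : X → ℕ} {body : X → ℕ → ℕ → ℕ} (hk : CmpLength k) (ha : Cmp a)
    (hb : Cmp (fun y : X × ℕ × ℕ => body y.1 y.2.1 y.2.2)) :
    Cmp (fun x => RAM.iter (k x) (a x) (body x)) :=
  Cmp.iter hk.2 hk.1 ha hb

@[fun_prop]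
theorem Cmp.not {P : X → Prop} (hP : Cmp P) : Cmp (fun x => ¬ P x) := by
  classical
  have : Cmp (fun x => if P x then 0 else 1) := by fun_prop
  refine (congrArg Cmp (funext fun x => ?_)).mp this.ne_zero
  simp

@[fun_prop]
theorem Cmp.and {P Q : X → Prop} (hP : Cmp P) (hQ : Cmp Q) : Cmp (fun x => P x ∧ Q x) := by
  classical
  have : Cmp (fun x => if P x then (if Q x then 1 else 0) else 0) := by fun_prop
  refine (congrArg Cmp (funext fun x => ?_)).mp this.ne_zero
  simp

@[fun_prop]
theorem Cmp.or {P Q : X → Prop} (hP : Cmp P) (hQ : Cmp Q) : Cmp (fun x => P x ∨ Q x) := by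
  classical
  have : Cmp (fun x => ¬ (¬ P x ∧ ¬ Q x)) := by fun_prop
  refine (congrArg Cmp (funext fun x => ?_)).mp this
  simp only [eq_iff_iff]; tauto

@[fun_prop]
theorem Cmp.imp {P Q : X → Prop} (hP : Cmp P) (hQ : Cmp Q) : Cmp (fun x => P x → Q x) := by
  have : Cmp (fun x => ¬ (P x ∧ ¬ Q x)) := by fun_prop
  refine (congrArg Cmp (funext fun x => ?_)).mp this
  simp only [eq_iff_iff]; tauto

@[fun_prop]
theorem Cmp.lt {f g : X → ℕ} (hf : Cmp f) (hg : Cmp g) : Cmp (fun x => f x < g x) := by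
  refine (congrArg Cmp (funext fun x => ?_)).mp (hg.sub hf).ne_zero
  simp only [eq_iff_iff]; omega

@[fun_prop]
theorem Cmp.le {f g : X → ℕ} (hf : Cmp f) (hg : Cmp g) : Cmp (fun x => f x ≤ g x) := by
  refine (congrArg Cmp (funext fun x => ?_)).mp (hg.lt hf).not
  simp only [eq_iff_iff]; omega

@[fun_prop]
theorem Cmp.eq {f g : X → ℕ} (hf : Cmp f) (hg : Cmp g) : Cmp (fun x => f x = g x) := by
  refine (congrArg Cmp (funext fun x => ?_)).mp ((hf.le hg).and (hg.le hf))
  simp only [eq_iff_iff]; omega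

@[fun_prop]
theorem Cmp.min {f g : X → ℕ} (hf : Cmp f) (hg : Cmp g) : Cmp (fun x => min (f x) (g x)) := by
  refine (congrArg Cmp (funext fun x => ?_)).mp (hf.sub (hf.sub hg))
  omega

@[fun_prop]
theorem Cmp.max {f g : X → ℕ} (hf : Cmp f) (hg : Cmp g) : Cmp (fun x => max (f x) (g x)) := by
  refine (congrArg Cmp (funext fun x => ?_)).mp (hf.add (hg.sub hf))
  omega

/-- `f 0 + ⋯ + f (k - 1)`. -/
def sumTo (k : ℕ) (f : ℕ → ℕ) : ℕ := ∑ i ∈ Finset.range k, f i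

open scoped Classical in
/-- The number of `i < k` with `P i`. -/
noncomputable def countTo (k : ℕ) (P : ℕ → Prop) : ℕ := ((Finset.range k).filter P).card

/-- Some `i < k` satisfies `P`. -/
def AnyTo (k : ℕ) (P : ℕ → Prop) : Prop := ∃ i < k, P i

/-- All `i < k` satisfy `P`. -/
def AllTo (k : ℕ) (P : ℕ → Prop) : Prop := ∀ i < k, P i

@[fun_prop]
theorem Cmp.sumTo {k : X → ℕ} {f : X → ℕ → ℕ} (hk : CmpLength k)
    (hf : Cmp (fun y : X × ℕ => f y.1 y.2)) : Cmp (fun x => sumTo (k x) (f x)) := by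
  have : Cmp (fun x => RAM.iter (k x) 0 (fun i acc => acc + f x i)) := by
    have : Cmp (fun y : X × ℕ × ℕ => f y.1 y.2.1) :=
      hf.comp (f := fun y : X × ℕ × ℕ => (y.1, y.2.1)) (by fun_prop)
    fun_prop
  refine (congrArg Cmp (funext fun x => ?_)).mp this
  generalize k x = k
  induction k with
  | zero => rfl
  | succ k ih => rw [iter_succ, ih, RAM.sumTo, RAM.sumTo, Finset.sum_range_succ]

@[fun_prop]
theorem Cmp.countTo {k : X → ℕ} {P : X → ℕ → Prop} (hk : CmpLength k)
    (hP : Cmp (fun y : X × ℕ => P y.1 y.2)) : Cmp (fun x => countTo (k x) (P x)) := by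
  classical
  have : Cmp (fun x => RAM.sumTo (k x) (fun i => if P x i then 1 else 0)) := by fun_prop
  refine (congrArg Cmp (funext fun x => ?_)).mp this
  rw [RAM.sumTo, RAM.countTo, Finset.card_filter]

@[fun_prop]
theorem Cmp.anyTo {k : X → ℕ} {P : X → ℕ → Prop} (hk : CmpLength k)
    (hP : Cmp (fun y : X × ℕ => P y.1 y.2)) : Cmp (fun x => AnyTo (k x) (P x)) := by
  have : Cmp (fun x => RAM.countTo (k x) (P x) ≠ 0) := by fun_prop
  refine (congrArg Cmp (funext fun x => ?_)).mp this
  simp [RAM.countTo, AnyTo, Finset.filter_eq_empty_iff]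

@[fun_prop]
theorem Cmp.allTo {k : X → ℕ} {P : X → ℕ → Prop} (hk : CmpLength k)
    (hP : Cmp (fun y : X × ℕ => P y.1 y.2)) : Cmp (fun x => AllTo (k x) (P x)) := by
  have : Cmp (fun x => ¬ AnyTo (k x) (fun i => ¬ P x i)) := by fun_prop
  refine (congrArg Cmp (funext fun x => ?_)).mp this
  simp [AnyTo, AllTo]

/-- The data that the algorithm works on: the contents `n` and `bound` of the input registers, a
bound `guesses` on the guesses, and the memory. -/
structure Inst where
  n : ℕ
  bound : ℕ
  guesses : ℕ
  mem : ℕ → ℕ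

instance : Layout Inst where
  Pos := ℕ × ℕ × ℕ
  Below p b := p.1 < b ∧ p.2.1 < b ∧ p.2.2 < b
  Rep I p s := s.reg p.1 = I.n ∧ s.reg p.2.1 = I.bound ∧ s.reg p.2.2 = I.guesses ∧ s.mem = I.mem
  size I := I.n + I.guesses + 1
  below_mono h h' := ⟨h.1.trans_le h', h.2.1.trans_le h', h.2.2.trans_le h'⟩
  rep_congr h hr he hm := ⟨(he _ h.1).trans hr.1, (he _ h.2.1).trans hr.2.1,
    (he _ h.2.2).trans hr.2.2.1, hm.trans hr.2.2.2⟩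

theorem Cmp.of_reg {f : X → ℕ} (q : Pos X → ℕ) (hq : ∀ pos b, Below pos b → q pos < b)
    (h : ∀ pos x s, Rep x pos s → s.reg (q pos) = f x) : Cmp f :=
  ⟨fun _ => Nat.zero_le _, fun _ _ => .skip, fun pos _ => q pos, fun _ b => b, 0, fun pos b hb =>
    ⟨le_rfl, hq pos b hb, fun x s hs =>
      ⟨1, s, .skip s, h pos x s hs, fun _ _ => rfl, rfl, by simp⟩⟩⟩

variable {f : X → Inst}

@[fun_prop]
theorem Cmp.n (hf : Cmp f) : Cmp (fun x => (f x).n) :=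
  Cmp.comp (g := Inst.n) (.of_reg (fun pos => pos.1) (fun _ _ h => h.1) fun _ _ _ h => h.1) hf

@[fun_prop]
theorem Cmp.bound (hf : Cmp f) : Cmp (fun x => (f x).bound) :=
  Cmp.comp (g := Inst.bound)
    (.of_reg (fun pos => pos.2.1) (fun _ _ h => h.2.1) fun _ _ _ h => h.2.1) hf

@[fun_prop]
theorem Cmp.guesses (hf : Cmp f) : Cmp (fun x => (f x).guesses) :=
  Cmp.comp (g := Inst.guesses)
    (.of_reg (fun pos => pos.2.2) (fun _ _ h => h.2.2) fun _ _ _ h => h.2.2.1) hf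

@[fun_prop]
theorem Cmp.mem {g : X → ℕ} (hf : Cmp f) (hg : Cmp g) : Cmp (fun x => (f x).mem (g x)) :=
  Cmp.comp (g := fun y : Inst × ℕ => y.1.mem y.2)
    (Cmp.of_instr (fun pos b => .load b pos.2) fun pos b _ y s hy => by
      rw [← (show s.reg pos.2 = y.2 from hy.2), ← (show s.mem = y.1.mem from hy.1.2.2.2)]
      exact .load _ _ s) (hf.prodMk hg)

@[fun_prop]
theorem CmpLength.n (hf : Cmp f) : CmpLength (fun x => (f x).n) :=
  ⟨hf.n, fun x =>
    le_trans (show _ ≤ (f x).n + (f x).guesses + 1 by beta_reduce; omega) (hf.1 x)⟩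

@[fun_prop]
theorem CmpLength.n_add_one (hf : Cmp f) : CmpLength (fun x => (f x).n + 1) :=
  ⟨by fun_prop, fun x =>
    le_trans (show _ ≤ (f x).n + (f x).guesses + 1 by beta_reduce; omega) (hf.1 x)⟩

@[fun_prop]
theorem CmpLength.guesses (hf : Cmp f) : CmpLength (fun x => (f x).guesses) :=
  ⟨hf.guesses, fun x =>
    le_trans (show _ ≤ (f x).n + (f x).guesses + 1 by beta_reduce; omega) (hf.1 x)⟩

end RAM

namespace RAM.Inst

variable {X : Type} [Layout X] {f : X → Inst} {a b c d : X → ℕ}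

/-! ### Numbers as arrays -/

/-- The product `n * i`. -/
def mulN (I : Inst) (i : ℕ) : ℕ := sumTo I.n fun _ => i

/-- `x * 2 ^ e`, provided that `e ≤ n`. -/
def shl (I : Inst) (e x : ℕ) : ℕ := iter I.n x fun i acc => if i < e then acc + acc else acc

/-- `x / 2 ^ e`, provided that `e ≤ n`. -/
def shr (I : Inst) (e x : ℕ) : ℕ := iter I.n x fun i acc => if i < e then hlf acc else acc

/-- The digit number `t` of `x` in base `2 ^ e`, provided that `e, t ≤ n`. -/
def digit (I : Inst) (e x t : ℕ) : ℕ :=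
  iter I.n x (fun i acc => if i < t then I.shr e acc else acc) -
    I.shl e (I.shr e (iter I.n x (fun i acc => if i < t then I.shr e acc else acc)))

/-- The entry `i ≤ n` of the array `A`: arrays have `n + 1` entries less than `2 ^ n`, and are
encoded as numbers in base `2 ^ n`. -/
def get (I : Inst) (A i : ℕ) : ℕ := I.digit I.n A i

/-- The array with entries `F 0, …, F n`. -/
def tab (I : Inst) (F : ℕ → ℕ) : ℕ := iter (I.n + 1) 0 fun i acc => I.shl I.n acc + F (I.n - i)

@[fun_prop]
theorem cmp_mulN (hf : Cmp f) (ha : Cmp a) : Cmp fun x => (f x).mulN (a x) := by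
  unfold mulN; fun_prop

@[fun_prop]
theorem cmp_shl (hf : Cmp f) (ha : Cmp a) (hb : Cmp b) : Cmp fun x => (f x).shl (a x) (b x) := by
  unfold shl; fun_prop

@[fun_prop]
theorem cmp_shr (hf : Cmp f) (ha : Cmp a) (hb : Cmp b) : Cmp fun x => (f x).shr (a x) (b x) := by
  unfold shr; fun_prop

@[fun_prop]
theorem cmp_digit (hf : Cmp f) (ha : Cmp a) (hb : Cmp b) (hc : Cmp c) :
    Cmp fun x => (f x).digit (a x) (b x) (c x) := by
  unfold digit; fun_prop

@[fun_prop]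
theorem cmp_get (hf : Cmp f) (ha : Cmp a) (hb : Cmp b) : Cmp fun x => (f x).get (a x) (b x) := by
  unfold get; fun_prop

@[fun_prop]
theorem cmp_tab {F : X → ℕ → ℕ} (hf : Cmp f) (hF : Cmp fun y : X × ℕ => F y.1 y.2) :
    Cmp fun x => (f x).tab (F x) := by
  have : Cmp (fun y : X × ℕ × ℕ => F y.1 ((f y.1).n - y.2.1)) :=
    hF.comp (f := fun y : X × ℕ × ℕ => (y.1, (f y.1).n - y.2.1)) (by fun_prop)
  unfold tab; fun_prop

/-! ### The modulator -/

/-- Adjacency, read off the memory. -/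
def Adj (I : Inst) (i j : ℕ) : Prop := i < I.n ∧ j < I.n ∧ I.mem (I.mulN i + j) ≠ 0

/-- `u`, `v`, `w` is an induced path. -/
def IsPath (I : Inst) (u v w : ℕ) : Prop := I.Adj u v ∧ I.Adj v w ∧ ¬ I.Adj u w ∧ u ≠ w

open scoped Classical in
/-- One step of the greedy packing: if the path `u`, `v`, `w` is induced and disjoint from `D`,
then its vertices are added to `D`. -/
noncomputable def pack (I : Inst) (D u v w : ℕ) : ℕ :=
  if I.IsPath u v w ∧ I.get D u = 0 ∧ I.get D v = 0 ∧ I.get D w = 0 then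
    I.tab fun x => if x = u ∨ x = v ∨ x = w then 1 else I.get D x
  else D

/-- The characteristic array of the vertices of a maximal packing of induced paths on three
vertices. -/
noncomputable def modulator (I : Inst) : ℕ :=
  iter I.n 0 fun u D => iter I.n D fun v D => iter I.n D fun w D => I.pack D u v w

/-- `v` is a vertex of the modulator. -/
def InD (I : Inst) (v : ℕ) : Prop := v < I.n ∧ I.get I.modulator v ≠ 0

/-- The size of the modulator. -/
noncomputable def dNum (I : Inst) : ℕ := countTo I.n I.InD

open scoped Classical in
/-- The number `2 ^ (d * d)`, where `d` is the size of the modulator; below it every sequence of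
`d` numbers less than `2 ^ d` is encoded. -/
noncomputable def numGuesses (I : Inst) : ℕ :=
  iter I.n 1 fun i acc => if i < I.dNum then I.shl I.dNum acc else acc

@[fun_prop]
theorem cmp_Adj (hf : Cmp f) (ha : Cmp a) (hb : Cmp b) : Cmp fun x => (f x).Adj (a x) (b x) := by
  unfold Adj; fun_prop

@[fun_prop]
theorem cmp_isPath (hf : Cmp f) (ha : Cmp a) (hb : Cmp b) (hc : Cmp c) :
    Cmp fun x => (f x).IsPath (a x) (b x) (c x) := by
  unfold IsPath; fun_prop

@[fun_prop]
theorem cmp_pack (hf : Cmp f) (ha : Cmp a) (hb : Cmp b) (hc : Cmp c) (hd : Cmp d) :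
    Cmp fun x => (f x).pack (a x) (b x) (c x) (d x) := by
  unfold pack; fun_prop

@[fun_prop]
theorem cmp_modulator (hf : Cmp f) : Cmp fun x => (f x).modulator := by
  unfold modulator; fun_prop

@[fun_prop]
theorem cmp_inD (hf : Cmp f) (ha : Cmp a) : Cmp fun x => (f x).InD (a x) := by
  unfold InD; fun_prop

@[fun_prop]
theorem cmp_dNum (hf : Cmp f) : Cmp fun x => (f x).dNum := by
  unfold dNum; fun_prop

@[fun_prop]
theorem cmp_numGuesses (hf : Cmp f) : Cmp fun x => (f x).numGuesses := by
  unfold numGuesses; fun_prop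

/-! ### The test of a guess -/

open scoped Classical in
/-- The label number `t` of the guess `w`, a number from `0` to `n`. -/
noncomputable def label (I : Inst) (w t : ℕ) : ℕ :=
  if I.digit I.dNum w t ≤ I.n then I.digit I.dNum w t else 0

/-- The label of the vertex `u` of the modulator: `0` if `u` is to be deleted, and otherwise the
number of the block that contains `u`. -/
noncomputable def lab (I : Inst) (w u : ℕ) : ℕ :=
  I.label w (countTo I.n fun v => v < u ∧ I.InD v)

/-- The neighbours of `v` in the modulator are deleted or belong to block `j`. -/
def Avail (I : Inst) (w j v : ℕ) : Prop :=
  AllTo I.n fun u => I.InD u → I.Adj u v → I.lab w u = 0 ∨ I.lab w u = j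

/-- `v` belongs to the clique of `r`. -/
def Mem (I : Inst) (r v : ℕ) : Prop := ¬ I.InD v ∧ (v = r ∨ I.Adj r v)

/-- `r` is the least vertex of its clique. -/
def IsRep (I : Inst) (r : ℕ) : Prop :=
  ¬ I.InD r ∧ AllTo I.n fun v => v < r → ¬ I.InD v → ¬ I.Adj v r

/-- The size of the clique of `r`. -/
noncomputable def sz (I : Inst) (r : ℕ) : ℕ := countTo I.n (I.Mem r)

/-- The number of vertices of the clique of `r` that can be kept if the clique joins block `j`. -/
noncomputable def av (I : Inst) (w j r : ℕ) : ℕ := countTo I.n fun v => I.Mem r v ∧ I.Avail w j v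

/-- The clique of `r` loses vertices whatever block it joins, if the threshold is `m`. -/
def Multi (I : Inst) (w m r : ℕ) : Prop :=
  I.IsRep r ∧ I.av w 0 r < m ∧ AllTo (I.n + 1) fun j => I.av w j r ≠ I.sz r

open scoped Classical in
/-- A block that the clique of `r` can join without losing a vertex, or `0` if there is none. -/
noncomputable def freeBlock (I : Inst) (w r : ℕ) : ℕ :=
  iter (I.n + 1) 0 fun j acc => if I.av w j r = I.sz r then j else acc

open scoped Classical in
/-- The block that the clique of `r` joins unless it is separated: this is guessed if the
clique loses vertices anyway. -/
noncomputable def joins (I : Inst) (w w' m r : ℕ) : ℕ :=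
  if I.Multi w m r then I.label w' (countTo I.n fun r' => r' < r ∧ I.Multi w m r')
  else I.freeBlock w r

/-- The number of vertices of the modulator in block `j`. -/
noncomputable def blk (I : Inst) (w j : ℕ) : ℕ := countTo I.n fun u => I.InD u ∧ I.lab w u = j

open scoped Classical in
/-- The dynamic program for block `j`: entry `s` is the maximum number of vertices of the cliques
assigned to block `j` that can be kept if at most `s` of them are in cliques not separated
from block `j`. -/
noncomputable def table (I : Inst) (w w' m j : ℕ) : ℕ :=
  iter I.n 0 fun r A => if I.IsRep r ∧ I.joins w w' m r = j then
    I.tab fun s => max (I.get A s + min (I.av w 0 r) m)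
      (I.get A (s - I.av w j r) + min (I.av w j r) s)
  else A

open scoped Classical in
/-- The maximum number of vertices that can be kept in block `j` and the cliques assigned to it.
As `0` stands for no block, the cliques assigned to it are all separated: its capacity is `0`. -/
noncomputable def part (I : Inst) (w w' m j : ℕ) : ℕ :=
  if j = 0 then I.get (I.table w w' m 0) 0
  else min (I.blk w j) m + I.get (I.table w w' m j) (m - I.blk w j)

/-- There is no edge between different blocks. -/
def Compat (I : Inst) (w : ℕ) : Prop :=
  AllTo I.n fun u => AllTo I.n fun v => I.InD u → I.InD v → I.Adj u v →
    I.lab w u = 0 ∨ I.lab w v = 0 ∨ I.lab w u = I.lab w v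

/-- The answer of the algorithm: for some threshold `m` and some guess, the number of deleted
vertices plus `m` is at most the bound. -/
def Accept (I : Inst) : Prop :=
  AnyTo (I.n + 1) fun m => AnyTo I.guesses fun w => AnyTo I.guesses fun w' =>
    I.Compat w ∧ I.n + m ≤ I.bound + sumTo (I.n + 1) (I.part w w' m)

@[fun_prop]
theorem cmp_label (hf : Cmp f) (ha : Cmp a) (hb : Cmp b) :
    Cmp fun x => (f x).label (a x) (b x) := by
  unfold label; fun_prop

@[fun_prop]
theorem cmp_lab (hf : Cmp f) (ha : Cmp a) (hb : Cmp b) : Cmp fun x => (f x).lab (a x) (b x) := by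
  unfold lab; fun_prop

@[fun_prop]
theorem cmp_avail (hf : Cmp f) (ha : Cmp a) (hb : Cmp b) (hc : Cmp c) :
    Cmp fun x => (f x).Avail (a x) (b x) (c x) := by
  unfold Avail; fun_prop

@[fun_prop]
theorem cmp_mem (hf : Cmp f) (ha : Cmp a) (hb : Cmp b) : Cmp fun x => (f x).Mem (a x) (b x) := by
  unfold Mem; fun_prop

@[fun_prop]
theorem cmp_isRep (hf : Cmp f) (ha : Cmp a) : Cmp fun x => (f x).IsRep (a x) := by
  unfold IsRep; fun_prop

@[fun_prop]
theorem cmp_sz (hf : Cmp f) (ha : Cmp a) : Cmp fun x => (f x).sz (a x) := by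
  unfold sz; fun_prop

@[fun_prop]
theorem cmp_av (hf : Cmp f) (ha : Cmp a) (hb : Cmp b) (hc : Cmp c) :
    Cmp fun x => (f x).av (a x) (b x) (c x) := by
  unfold av; fun_prop

@[fun_prop]
theorem cmp_multi (hf : Cmp f) (ha : Cmp a) (hb : Cmp b) (hc : Cmp c) :
    Cmp fun x => (f x).Multi (a x) (b x) (c x) := by
  unfold Multi; fun_prop

@[fun_prop]
theorem cmp_freeBlock (hf : Cmp f) (ha : Cmp a) (hb : Cmp b) :
    Cmp fun x => (f x).freeBlock (a x) (b x) := by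
  unfold freeBlock; fun_prop

@[fun_prop]
theorem cmp_joins (hf : Cmp f) (ha : Cmp a) (hb : Cmp b) (hc : Cmp c) (hd : Cmp d) :
    Cmp fun x => (f x).joins (a x) (b x) (c x) (d x) := by
  unfold joins; fun_prop

@[fun_prop]
theorem cmp_blk (hf : Cmp f) (ha : Cmp a) (hb : Cmp b) : Cmp fun x => (f x).blk (a x) (b x) := by
  unfold blk; fun_prop

@[fun_prop]
theorem cmp_table (hf : Cmp f) (ha : Cmp a) (hb : Cmp b) (hc : Cmp c) (hd : Cmp d) :
    Cmp fun x => (f x).table (a x) (b x) (c x) (d x) := by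
  unfold table; fun_prop

@[fun_prop]
theorem cmp_part (hf : Cmp f) (ha : Cmp a) (hb : Cmp b) (hc : Cmp c) (hd : Cmp d) :
    Cmp fun x => (f x).part (a x) (b x) (c x) (d x) := by
  unfold part; fun_prop

@[fun_prop]
theorem cmp_compat (hf : Cmp f) (ha : Cmp a) : Cmp fun x => (f x).Compat (a x) := by
  unfold Compat; fun_prop

theorem cmp_accept (hf : Cmp f) : Cmp fun x => (f x).Accept := by
  unfold Accept; fun_prop

end RAM.Inst

namespace RAM

/-! ### Arithmetic of the encodings -/

theorem iter_ite_lt (g : ℕ → ℕ) (e x k : ℕ) :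
    iter k x (fun i acc => if i < e then g acc else acc) = g^[min k e] x := by
  induction k with
  | zero => simp
  | succ k ih =>
    rw [iter_succ, ih]
    split_ifs with h
    · rw [min_eq_left h.le, min_eq_left (Nat.succ_le_of_lt h), Function.iterate_succ_apply']
    · rw [min_eq_right (by omega), min_eq_right (by omega)]

theorem iter_induction (Q : ℕ → Prop) {k a : ℕ} {body : ℕ → ℕ → ℕ} (h0 : Q a)
    (hs : ∀ i < k, ∀ acc, Q acc → Q (body i acc)) : Q (iter k a body) := by
  induction k with
  | zero => exact h0
  | succ k ih => exact hs k (by omega) _ (ih fun i hi => hs i (by omega))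

/-- In a loop whose steps go up in a preorder, a property that step `i` establishes and that is
inherited upwards holds in the end. -/
theorem iter_reaches {R : ℕ → ℕ → Prop} (refl : ∀ x, R x x)
    (trans : ∀ x y z, R x y → R y z → R x z) {S : ℕ → ℕ → Prop}
    (hS : ∀ i x y, R x y → S i x → S i y) {k a : ℕ} {body : ℕ → ℕ → ℕ}
    (hb : ∀ i < k, ∀ acc, R acc (body i acc) ∧ S i (body i acc)) :
    R a (iter k a body) ∧ ∀ i < k, S i (iter k a body) := by
  induction k with
  | zero => exact ⟨refl a, fun i hi => absurd hi (Nat.not_lt_zero i)⟩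
  | succ k ih =>
    obtain ⟨h1, h2⟩ := ih fun i hi => hb i (by omega)
    obtain ⟨h3, h4⟩ := hb k (by omega) (iter k a body)
    refine ⟨trans _ _ _ h1 h3, fun i hi => ?_⟩
    rcases Nat.lt_succ_iff_lt_or_eq.1 hi with hi | rfl
    · exact hS _ _ _ h3 (h2 i hi)
    · exact h4

namespace Inst

theorem mulN_eq (I : Inst) (i : ℕ) : I.mulN i = I.n * i := by
  simp [mulN, sumTo]

theorem shl_eq (I : Inst) {e : ℕ} (he : e ≤ I.n) (x : ℕ) : I.shl e x = x * 2 ^ e := by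
  rw [shl, iter_ite_lt (fun acc => acc + acc), min_eq_right he]
  clear he
  induction e with
  | zero => simp
  | succ e ih => rw [Function.iterate_succ_apply', ih, pow_succ]; ring

theorem shr_eq (I : Inst) {e : ℕ} (he : e ≤ I.n) (x : ℕ) : I.shr e x = x / 2 ^ e := by
  rw [shr, iter_ite_lt hlf, min_eq_right he]
  clear he
  induction e with
  | zero => simp
  | succ e ih => rw [Function.iterate_succ_apply', ih, pow_succ, hlf, Nat.div_div_eq_div_mul]

theorem digit_eq (I : Inst) {e t : ℕ} (he : e ≤ I.n) (ht : t ≤ I.n) (x : ℕ) :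
    I.digit e x t = x / (2 ^ e) ^ t % 2 ^ e := by
  have h : iter I.n x (fun i acc => if i < t then I.shr e acc else acc) = x / (2 ^ e) ^ t := by
    rw [iter_ite_lt (I.shr e), min_eq_right ht]
    clear ht
    induction t with
    | zero => simp
    | succ t ih =>
      rw [Function.iterate_succ_apply', ih, I.shr_eq he, pow_succ, Nat.div_div_eq_div_mul]
  rw [digit, h, I.shr_eq he, I.shl_eq he, Nat.mod_eq_sub_div_mul]

theorem get_lt (I : Inst) (A : ℕ) {i : ℕ} (hi : i ≤ I.n) : I.get A i < 2 ^ I.n := by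
  rw [get, I.digit_eq le_rfl hi]
  exact Nat.mod_lt _ (by positivity)

theorem get_zero (I : Inst) {i : ℕ} (hi : i ≤ I.n) : I.get 0 i = 0 := by
  rw [get, I.digit_eq le_rfl hi]; simp

theorem get_tab (I : Inst) {F : ℕ → ℕ} (hF : ∀ i ≤ I.n, F i < 2 ^ I.n) {i : ℕ} (hi : i ≤ I.n) :
    I.get (I.tab F) i = F i := by
  have key : ∀ k ≤ I.n + 1, ∀ t < k,
      iter k 0 (fun i acc => I.shl I.n acc + F (I.n - i)) / (2 ^ I.n) ^ t % 2 ^ I.n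
        = F (I.n + 1 - k + t) := by
    intro k
    induction k with
    | zero => intro _ t ht; omega
    | succ k ih =>
      intro hk t ht
      rw [iter_succ, I.shl_eq le_rfl]
      have hlt := hF (I.n - k) (by omega)
      cases t with
      | zero =>
        rw [pow_zero, Nat.div_one, Nat.mul_comm, Nat.mul_add_mod, Nat.mod_eq_of_lt hlt]
        congr 1; omega
      | succ t =>
        rw [pow_succ', ← Nat.div_div_eq_div_mul, Nat.mul_comm _ (2 ^ I.n),
          Nat.mul_add_div (by positivity), Nat.div_eq_of_lt hlt, add_zero,
          ih (by omega) t (by omega)]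
        congr 1; omega
  rw [get, I.digit_eq le_rfl hi, tab, key _ le_rfl i (by omega)]
  congr 1; omega

/-- Every sequence of `k` digits is encoded by a number. -/
theorem exists_digits (B : ℕ) (k : ℕ) (δ : ℕ → ℕ) (hδ : ∀ t, δ t < B) :
    ∃ w < B ^ k, ∀ t < k, w / B ^ t % B = δ t := by
  induction k generalizing δ with
  | zero => exact ⟨0, by simp, fun t ht => absurd ht (Nat.not_lt_zero t)⟩
  | succ k ih =>
    obtain ⟨w, hw, h⟩ := ih (fun t => δ (t + 1)) fun t => hδ _
    have h0 := hδ 0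
    refine ⟨B * w + δ 0, ?_, fun t ht => ?_⟩
    · rw [pow_succ']
      calc B * w + δ 0 < B * w + B := by omega
        _ = B * (w + 1) := by ring
        _ ≤ _ := Nat.mul_le_mul_left _ hw
    · cases t with
      | zero => rw [pow_zero, Nat.div_one, Nat.mul_add_mod, Nat.mod_eq_of_lt h0]
      | succ t =>
        rw [pow_succ', ← Nat.div_div_eq_div_mul, Nat.mul_add_div (by omega), Nat.div_eq_of_lt h0,
          add_zero, h t (by omega)]

theorem dNum_le (I : Inst) : I.dNum ≤ I.n := by
  classical
  exact (Finset.card_filter_le _ _).trans (Finset.card_range _).le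

theorem numGuesses_eq (I : Inst) : I.numGuesses = (2 ^ I.dNum) ^ I.dNum := by
  have h : ∀ k, (I.shl I.dNum)^[k] 1 = (2 ^ I.dNum) ^ k := by
    intro k
    induction k with
    | zero => simp
    | succ k ih => rw [Function.iterate_succ_apply', ih, I.shl_eq I.dNum_le, pow_succ]
  rw [numGuesses]
  have := iter_ite_lt (I.shl I.dNum) I.dNum 1 I.n
  rw [min_eq_right I.dNum_le, h] at this
  rw [← this]

/-! ### The modulator meets all induced paths -/

/-- The memory holds the adjacency matrix of a simple graph. -/
structure IsGraph (I : Inst) : Prop where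
  symm : ∀ {i j}, I.Adj i j → I.Adj j i
  irrefl : ∀ i, ¬ I.Adj i i

theorem get_pack_ne_zero_iff (I : Inst) (D : ℕ) {u v w x : ℕ} (hx : x < I.n) :
    (I.get (I.pack D u v w) x ≠ 0 ↔ I.get D x ≠ 0 ∨
      (I.IsPath u v w ∧ I.get D u = 0 ∧ I.get D v = 0 ∧ I.get D w = 0) ∧
        (x = u ∨ x = v ∨ x = w)) := by
  classical
  rw [pack]
  split_ifs with h
  · rw [I.get_tab (fun i hi => ?_) hx.le]
    · simp only [h, and_self, true_and]
      split_ifs with h' <;> simp [h']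
    · split_ifs
      · exact Nat.one_lt_two_pow (by omega)
      · exact I.get_lt D hi
  · simp [h]

theorem modulator_induction (I : Inst) (Q : ℕ → Prop) (h0 : Q 0)
    (hs : ∀ u < I.n, ∀ v < I.n, ∀ w < I.n, ∀ D, Q D → Q (I.pack D u v w)) : Q I.modulator :=
  iter_induction Q h0 fun u hu _ h => iter_induction Q h fun v hv _ h =>
    iter_induction Q h fun w hw _ h => hs u hu v hv w hw _ h

theorem inD_of_isPath (I : Inst) {u v w : ℕ} (h : I.IsPath u v w) :
    I.InD u ∨ I.InD v ∨ I.InD w := by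
  have hu : u < I.n := h.1.1
  have hv : v < I.n := h.1.2.1
  have hw : w < I.n := h.2.1.2.1
  let R : ℕ → ℕ → Prop := fun D D' => ∀ x < I.n, I.get D x ≠ 0 → I.get D' x ≠ 0
  have refl : ∀ D, R D D := fun D x _ h => h
  have trans : ∀ D D' D'', R D D' → R D' D'' → R D D'' := fun D D' D'' h h' x hx hD =>
    h' x hx (h x hx hD)
  let S : ℕ → ℕ → ℕ → ℕ → Prop := fun u v w D => I.IsPath u v w →
    I.get D u ≠ 0 ∨ I.get D v ≠ 0 ∨ I.get D w ≠ 0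
  have hS : ∀ u v w D D', R D D' → S u v w D → S u v w D' := by
    intro u v w D D' hR hS hp
    have hu : u < I.n := hp.1.1
    have hv : v < I.n := hp.1.2.1
    have hw : w < I.n := hp.2.1.2.1
    exact (hS hp).imp (hR u hu) (Or.imp (hR v hv) (hR w hw))
  have step : ∀ u v w D, R D (I.pack D u v w) ∧ S u v w (I.pack D u v w) := by
    intro u v w D
    refine ⟨fun x hx h => (I.get_pack_ne_zero_iff D hx).2 (Or.inl h), fun hp => ?_⟩
    have hu : u < I.n := hp.1.1
    have hv : v < I.n := hp.1.2.1
    have hw : w < I.n := hp.2.1.2.1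
    rw [I.get_pack_ne_zero_iff D hu, I.get_pack_ne_zero_iff D hv, I.get_pack_ne_zero_iff D hw]
    tauto
  have l1 : ∀ u v D, R D (iter I.n D fun w D => I.pack D u v w) ∧
      ∀ w < I.n, S u v w (iter I.n D fun w D => I.pack D u v w) := fun u v D =>
    iter_reaches refl trans (S := fun w => S u v w) (fun w => hS u v w) fun w _ D => step u v w D
  have l2 : ∀ u D, R D (iter I.n D fun v D => iter I.n D fun w D => I.pack D u v w) ∧
      ∀ v < I.n, ∀ w < I.n, S u v w (iter I.n D fun v D => iter I.n D fun w D => I.pack D u v w) :=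
    fun u D => iter_reaches refl trans (S := fun v D => ∀ w < I.n, S u v w D)
      (fun v D D' h h' w hw => hS u v w _ _ h (h' w hw)) fun v _ D => l1 u v D
  have l3 := iter_reaches (k := I.n) (a := 0) refl trans
    (S := fun u D => ∀ v < I.n, ∀ w < I.n, S u v w D)
    (fun u D D' h h' v hv w hw => hS u v w _ _ h (h' v hv w hw)) fun u _ D => l2 u D
  have := l3.2 u hu v hv w hw h
  simp only [InD, hu, hv, hw, true_and]
  exact this

/-- Outside the modulator, adjacency is transitive. -/
theorem adj_trans (I : Inst) {u v w : ℕ} (hu : ¬ I.InD u) (hv : ¬ I.InD v) (hw : ¬ I.InD w)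
    (huv : I.Adj u v) (hvw : I.Adj v w) (h : u ≠ w) : I.Adj u w := by
  by_contra h'
  rcases I.inD_of_isPath ⟨huv, hvw, h', h⟩ with h | h | h <;> contradiction

/-- The modulator is a union of disjoint triples each of which meets every set `T` that meets
all induced paths. -/
theorem dNum_le_three_mul (I : Inst) (T : Finset ℕ)
    (hT : ∀ u v w, I.IsPath u v w → u ∈ T ∨ v ∈ T ∨ w ∈ T) : I.dNum ≤ 3 * T.card := by
  classical
  let s : ℕ → Finset ℕ := fun D => (Finset.range I.n).filter fun v => I.get D v ≠ 0
  have key : (s I.modulator).card ≤ 3 * (s I.modulator ∩ T).card := by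
    refine I.modulator_induction (fun D => (s D).card ≤ 3 * (s D ∩ T).card) ?_ ?_
    · have : s 0 = ∅ := by
        refine Finset.filter_eq_empty_iff.2 fun x hx => ?_
        rw [I.get_zero (Finset.mem_range.1 hx).le]; simp
      simp [this]
    · intro u hu v hv w hw D hD
      by_cases h : I.IsPath u v w ∧ I.get D u = 0 ∧ I.get D v = 0 ∧ I.get D w = 0
      · have hs : s (I.pack D u v w) = s D ∪ {u, v, w} := by
          ext x
          simp only [s, Finset.mem_filter, Finset.mem_range, Finset.mem_union, Finset.mem_insert,
            Finset.mem_singleton]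
          constructor
          · rintro ⟨hx, h'⟩
            rw [I.get_pack_ne_zero_iff D hx] at h'
            tauto
          · intro h'
            have hx : x < I.n := by rcases h' with h' | rfl | rfl | rfl <;> tauto
            rw [I.get_pack_ne_zero_iff D hx]
            tauto
        have hdis : ∀ x ∈ ({u, v, w} : Finset ℕ), x ∉ s D := by
          intro x hx hx'
          simp only [s, Finset.mem_filter] at hx'
          simp only [Finset.mem_insert, Finset.mem_singleton] at hx
          rcases hx with rfl | rfl | rfl <;> tauto
        have h3 : ({u, v, w} : Finset ℕ).card ≤ 3 := Finset.card_le_three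
        obtain ⟨x, hx, hxT⟩ : ∃ x ∈ ({u, v, w} : Finset ℕ), x ∈ T := by
          rcases hT u v w h.1 with h | h | h
          exacts [⟨u, by simp, h⟩, ⟨v, by simp, h⟩, ⟨w, by simp, h⟩]
        have h1 : (insert x (s D ∩ T)).card ≤ (s (I.pack D u v w) ∩ T).card := by
          refine Finset.card_le_card ?_
          rw [hs]
          intro y hy
          rcases Finset.mem_insert.1 hy with rfl | hy
          · exact Finset.mem_inter.2 ⟨Finset.mem_union_right _ hx, hxT⟩
          · exact Finset.mem_inter.2 ⟨Finset.mem_union_left _ (Finset.mem_inter.1 hy).1,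
              (Finset.mem_inter.1 hy).2⟩
        rw [Finset.card_insert_of_notMem fun h' => hdis x hx (Finset.mem_inter.1 h').1] at h1
        have h2 : (s (I.pack D u v w)).card ≤ (s D).card + ({u, v, w} : Finset ℕ).card := by
          rw [hs]; exact Finset.card_union_le _ _
        omega
      · rwa [pack, if_neg h]
  have hs : I.dNum = (s I.modulator).card := by
    rw [dNum, countTo]
    refine congrArg Finset.card (Finset.filter_congr fun x hx => ?_)
    simp [InD, Finset.mem_range.1 hx]
  rw [hs]
  exact key.trans (Nat.mul_le_mul_left 3 (Finset.card_le_card Finset.inter_subset_right))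

end Inst
end RAM

namespace RAM

/-! ### The knapsack recursion -/

open scoped Classical in
/-- The items `r < k` with `R r` are either separated, for a gain of `g r`, or put into a bin,
where they have size `a r`; `knap R g a k s` is the maximum of the gain plus the used space of
a bin of capacity `s` (an item may be put into the bin partially). -/
noncomputable def knap (R : ℕ → Prop) (g a : ℕ → ℕ) : ℕ → ℕ → ℕ
  | 0, _ => 0
  | k + 1, s => if R k then max (knap R g a k s + g k) (knap R g a k (s - a k) + min (a k) s)
    else knap R g a k s

open scoped Classical in
/-- The items `r < k` with `R r`. -/
noncomputable def below (R : ℕ → Prop) (k : ℕ) : Finset ℕ := (Finset.range k).filter R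

section knap

variable {R : ℕ → Prop} {g a : ℕ → ℕ}

theorem mem_below {k r : ℕ} : r ∈ below R k ↔ r < k ∧ R r := by
  simp [below]

theorem below_succ_of {k : ℕ} (h : R k) : below R (k + 1) = insert k (below R k) := by
  classical
  simp only [below]
  rw [Finset.range_add_one, Finset.filter_insert, if_pos h]

theorem below_succ_of_not {k : ℕ} (h : ¬ R k) : below R (k + 1) = below R k := by
  classical
  simp only [below]
  rw [Finset.range_add_one, Finset.filter_insert, if_neg h]

theorem notMem_below (k : ℕ) : k ∉ below R k := by
  simp [mem_below]

theorem exists_knap_le (R : ℕ → Prop) (g a : ℕ → ℕ) (k s : ℕ) : ∃ X ⊆ below R k,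
    knap R g a k s ≤ ∑ r ∈ X, g r + min (∑ r ∈ below R k \ X, a r) s := by
  induction k generalizing s with
  | zero => exact ⟨∅, by simp, by simp [knap]⟩
  | succ k ih =>
    rw [knap]
    split_ifs with h
    · have hk := notMem_below (R := R) k
      rw [below_succ_of h]
      rcases le_total (knap R g a k s + g k) (knap R g a k (s - a k) + min (a k) s) with h' | h'
      · rw [max_eq_right h']
        obtain ⟨X, hX, hs⟩ := ih (s - a k)
        have hkX : k ∉ X := fun h => hk (hX h)
        refine ⟨X, hX.trans (Finset.subset_insert _ _), ?_⟩
        rw [Finset.insert_sdiff_of_notMem _ hkX, Finset.sum_insert (by simp [hk])]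
        omega
      · rw [max_eq_left h']
        obtain ⟨X, hX, hs⟩ := ih s
        have hkX : k ∉ X := fun h => hk (hX h)
        refine ⟨insert k X, Finset.insert_subset_insert _ hX, ?_⟩
        rw [Finset.insert_sdiff_insert, Finset.sdiff_insert_of_notMem hk, Finset.sum_insert hkX]
        omega
    · rw [below_succ_of_not h]
      exact ih s

theorem le_knap {k : ℕ} (s : ℕ) {X : Finset ℕ} (hX : X ⊆ below R k) :
    ∑ r ∈ X, g r + min (∑ r ∈ below R k \ X, a r) s ≤ knap R g a k s := by
  induction k generalizing s X with
  | zero =>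
    have : X = ∅ := by simpa [below] using hX
    simp [this, below]
  | succ k ih =>
    rw [knap]
    split_ifs with h
    · have hk := notMem_below (R := R) k
      rw [below_succ_of h] at hX ⊢
      by_cases hkX : k ∈ X
      · obtain ⟨Y, hY, rfl⟩ : ∃ Y, k ∉ Y ∧ X = insert k Y :=
          ⟨X.erase k, Finset.notMem_erase _ _, (Finset.insert_erase hkX).symm⟩
        have hY' : Y ⊆ below R k := (Finset.insert_subset_insert_iff hY).1 hX
        rw [Finset.insert_sdiff_insert, Finset.sdiff_insert_of_notMem hk, Finset.sum_insert hY]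
        exact le_trans (by have := ih s hY'; omega) (le_max_left _ _)
      · have hX' : X ⊆ below R k := (Finset.subset_insert_iff_of_notMem hkX).1 hX
        rw [Finset.insert_sdiff_of_notMem _ hkX, Finset.sum_insert (by simp [hk])]
        exact le_trans (by have := ih (s - a k) hX'; omega) (le_max_right _ _)
    · rw [below_succ_of_not h] at hX ⊢
      exact ih s hX

theorem knap_le_sum {b : ℕ → ℕ} (hg : ∀ r, g r ≤ b r) (ha : ∀ r, a r ≤ b r) (k s : ℕ) :
    knap R g a k s ≤ ∑ r ∈ below R k, b r := by
  obtain ⟨X, hX, h⟩ := exists_knap_le R g a k s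
  have h1 := Finset.sum_le_sum fun r (_ : r ∈ X) => hg r
  have h2 := Finset.sum_le_sum fun r (_ : r ∈ below R k \ X) => ha r
  have h3 := Finset.sum_sdiff (f := b) hX
  omega

end knap

theorem countTo_eq_card (k : ℕ) (P : ℕ → Prop) : countTo k P = (below P k).card := rfl

theorem countTo_mono {k : ℕ} {P Q : ℕ → Prop} (h : ∀ v < k, P v → Q v) :
    countTo k P ≤ countTo k Q := by
  rw [countTo_eq_card, countTo_eq_card]
  exact Finset.card_le_card fun v hv =>
    mem_below.2 ⟨(mem_below.1 hv).1, h v (mem_below.1 hv).1 (mem_below.1 hv).2⟩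

theorem countTo_le (k : ℕ) (P : ℕ → Prop) : countTo k P ≤ k := by
  classical
  exact (Finset.card_filter_le _ _).trans (Finset.card_range _).le

theorem countTo_lt_countTo {k : ℕ} {P Q : ℕ → Prop} (h : ∀ v, P v → Q v) {u : ℕ} (hu : u < k)
    (hP : ¬ P u) (hQ : Q u) : countTo k P < countTo k Q := by
  rw [countTo_eq_card, countTo_eq_card]
  refine Finset.card_lt_card ((Finset.ssubset_iff_of_subset fun v hv => ?_).2
    ⟨u, mem_below.2 ⟨hu, hQ⟩, fun h => hP (mem_below.1 h).2⟩)
  exact mem_below.2 ⟨(mem_below.1 hv).1, h v (mem_below.1 hv).2⟩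

namespace Inst

variable {I : Inst}

/-! ### The cliques outside the modulator -/

/-- The least vertices of the cliques. -/
noncomputable def reps (I : Inst) : Finset ℕ := below I.IsRep I.n

theorem exists_rep {v : ℕ} (hv : v < I.n) (hD : ¬ I.InD v) :
    ∃ r ∈ I.reps, I.Mem r v := by
  classical
  have hex : ∃ r, ¬ I.InD r ∧ (v = r ∨ I.Adj r v) := ⟨v, hD, Or.inl rfl⟩
  obtain ⟨h1, h2⟩ := Nat.find_spec hex
  have hmin := fun u => Nat.find_min (m := u) hex
  generalize Nat.find hex = r at h1 h2 hmin
  have hr : r < I.n := by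
    rcases h2 with rfl | h2
    exacts [hv, h2.1]
  refine ⟨r, mem_below.2 ⟨hr, h1, fun u hu hur huD hadj => ?_⟩, hD, h2⟩
  have hu' := hmin u hur
  rcases h2 with rfl | h2
  · exact hu' ⟨huD, Or.inr hadj⟩
  · by_cases huv : u = v
    · exact hu' ⟨huD, Or.inl huv.symm⟩
    · exact hu' ⟨huD, Or.inr (I.adj_trans huD h1 hD hadj h2 huv)⟩

theorem mem_adj (hI : I.IsGraph) {r u v : ℕ} (hr : r ∈ I.reps) (hu : I.Mem r u) (hv : I.Mem r v)
    (huv : u ≠ v) : I.Adj u v := by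
  have hrD : ¬ I.InD r := (mem_below.1 hr).2.1
  rcases hu with ⟨huD, rfl | hu⟩ <;> rcases hv with ⟨hvD, rfl | hv⟩
  · exact absurd rfl huv
  · exact hv
  · exact hI.symm hu
  · exact I.adj_trans huD hrD hvD (hI.symm hu) hv huv

theorem rep_unique (hI : I.IsGraph) {r r' v : ℕ} (hr : r ∈ I.reps) (hr' : r' ∈ I.reps)
    (h : I.Mem r v) (h' : I.Mem r' v) : r = r' := by
  have key : ∀ r ∈ I.reps, ∀ r' ∈ I.reps, I.Mem r v → I.Mem r' v → ¬ r < r' := by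
    intro r hr r' hr' h h' hlt
    obtain ⟨hn, hD, -⟩ := mem_below.1 hr
    obtain ⟨hn', hD', hmin⟩ := mem_below.1 hr'
    refine hmin r hn hlt hD ?_
    rcases h with ⟨hvD, rfl | h⟩ <;> rcases h' with ⟨-, rfl | h'⟩
    · exact absurd hlt (lt_irrefl _)
    · exact hI.symm h'
    · exact h
    · exact I.adj_trans hD hvD hD' h (hI.symm h') hlt.ne
  have h1 := key r hr r' hr' h h'
  have h2 := key r' hr' r hr h' h
  omega

theorem mem_of_adj {r u v : ℕ} (hr : r ∈ I.reps) (hu : I.Mem r u)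
    (hv : ¬ I.InD v) (h : I.Adj u v) : I.Mem r v := by
  refine ⟨hv, ?_⟩
  by_cases hrv : v = r
  · exact Or.inl hrv
  · rcases hu with ⟨huD, rfl | hu⟩
    · exact Or.inr h
    · exact Or.inr (I.adj_trans (mem_below.1 hr).2.1 huD hv hu h (Ne.symm hrv))

/-- Counting in the cliques separately: they are disjoint. -/
theorem sum_countTo_mem (hI : I.IsGraph) {S : Finset ℕ} (hS : S ⊆ I.reps) (P : ℕ → ℕ → Prop) :
    ∑ r ∈ S, countTo I.n (fun v => I.Mem r v ∧ P r v)
      = (below (fun v => ∃ r ∈ S, I.Mem r v ∧ P r v) I.n).card := by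
  classical
  have : below (fun v => ∃ r ∈ S, I.Mem r v ∧ P r v) I.n
      = S.biUnion fun r => below (fun v => I.Mem r v ∧ P r v) I.n := by
    ext v
    simp only [mem_below, Finset.mem_biUnion]
    tauto
  rw [this, Finset.card_biUnion]
  · rfl
  · intro r hr r' hr' hne
    refine Finset.disjoint_left.2 fun v hv hv' => hne ?_
    exact rep_unique hI (hS hr) (hS hr') (mem_below.1 hv).2.1 (mem_below.1 hv').2.1

theorem av_le_sz (w j r : ℕ) : I.av w j r ≤ I.sz r :=
  countTo_mono fun _ _ h => h.1

theorem sum_sz_le (hI : I.IsGraph) : ∑ r ∈ I.reps, I.sz r ≤ I.n := by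
  have h := sum_countTo_mem hI (Finset.Subset.refl I.reps) fun _ _ => True
  simp only [and_true] at h
  rw [show ∑ r ∈ I.reps, I.sz r = _ from h]
  refine (Finset.card_le_card (t := Finset.range I.n) fun v hv => ?_).trans (by simp)
  exact Finset.mem_range.2 (mem_below.1 hv).1

/-! ### The table of the dynamic program -/

/-- The representatives of the cliques that are assigned to block `j`. -/
noncomputable def assigned (I : Inst) (w w' m j : ℕ) : Finset ℕ :=
  below (fun r => I.IsRep r ∧ I.joins w w' m r = j) I.n

theorem mem_assigned {w w' m j r : ℕ} :
    r ∈ I.assigned w w' m j ↔ r ∈ I.reps ∧ I.joins w w' m r = j := by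
  simp [assigned, reps, mem_below, and_assoc]

theorem get_table (hI : I.IsGraph) (w w' m j : ℕ) {s : ℕ} (hs : s ≤ I.n) :
    I.get (I.table w w' m j) s = knap (fun r => I.IsRep r ∧ I.joins w w' m r = j)
      (fun r => min (I.av w 0 r) m) (I.av w j) I.n s := by
  classical
  rw [table]
  have key : ∀ k ≤ I.n, ∀ s ≤ I.n,
      I.get (iter k 0 fun r A => if I.IsRep r ∧ I.joins w w' m r = j then
        I.tab fun s => max (I.get A s + min (I.av w 0 r) m)
          (I.get A (s - I.av w j r) + min (I.av w j r) s)
        else A) s = knap (fun r => I.IsRep r ∧ I.joins w w' m r = j)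
          (fun r => min (I.av w 0 r) m) (I.av w j) k s := by
    intro k
    induction k with
    | zero => intro _ s hs; rw [iter_zero, I.get_zero hs, knap]
    | succ k ih =>
      intro hk s hs
      rw [iter_succ]
      -- the values fit into an entry, as they do not exceed the number of vertices
      have hlt : ∀ s, knap (fun r => I.IsRep r ∧ I.joins w w' m r = j)
          (fun r => min (I.av w 0 r) m) (I.av w j) (k + 1) s < 2 ^ I.n := by
        intro s
        refine lt_of_le_of_lt ?_ (Nat.lt_two_pow_self (n := I.n))
        refine (knap_le_sum (b := I.sz) (fun r => (min_le_left _ _).trans (av_le_sz _ _ _))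
          (fun r => av_le_sz _ _ _) _ _).trans ((Finset.sum_le_sum_of_subset ?_).trans
            (sum_sz_le hI))
        intro r hr
        obtain ⟨h1, h2, -⟩ := mem_below.1 hr
        exact mem_below.2 ⟨by omega, h2⟩
      by_cases h : I.IsRep k ∧ I.joins w w' m k = j
      · simp only [knap, if_pos h] at hlt ⊢
        rw [I.get_tab (fun i hi => ?_) hs]
        · rw [ih (by omega) s hs, ih (by omega) _ (by omega)]
        · rw [ih (by omega) i hi, ih (by omega) _ (by omega)]
          exact hlt i
      · simp only [knap, if_neg h]
        exact ih (by omega) s hs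
  convert key I.n le_rfl s hs

end Inst
end RAM

namespace RAM.Inst

variable {I : Inst}

/-! ### From labels to a set of kept vertices -/

/-- `K` can be kept with threshold `m`: it can be coloured such that adjacent vertices have the
same colour and every colour occurs at most `m` times. -/
def Cert (I : Inst) (m : ℕ) (K : Finset ℕ) : Prop :=
  K ⊆ Finset.range I.n ∧ ∃ col : ℕ → ℕ, (∀ u ∈ K, ∀ v ∈ K, I.Adj u v → col u = col v) ∧
    ∀ q, (K.filter (col · = q)).card ≤ m

/-- Every colour class of `E` can be reduced to at most `m` elements; the colours in `Q` are those
that are counted. -/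
theorem exists_truncation (E Q : Finset ℕ) (c : ℕ → ℕ) (m : ℕ) :
    ∃ K ⊆ E, (∀ q, (K.filter (c · = q)).card ≤ m) ∧
      ∑ q ∈ Q, min (E.filter (c · = q)).card m ≤ K.card := by
  have h : ∀ q, ∃ L ⊆ E.filter (c · = q), L.card = min (E.filter (c · = q)).card m :=
    fun q => Finset.exists_subset_card_eq (min_le_left _ _)
  choose L hL hc using h
  have hLc : ∀ {q v}, v ∈ L q → v ∈ E ∧ c v = q := fun hv => Finset.mem_filter.1 (hL _ hv)
  refine ⟨Q.biUnion L, ?_, fun q => ?_, ?_⟩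
  · exact Finset.biUnion_subset.2 fun q _ v hv => (hLc hv).1
  · have : (Q.biUnion L).filter (c · = q) ⊆ L q := by
      intro v hv
      obtain ⟨hv, hq⟩ := Finset.mem_filter.1 hv
      obtain ⟨q', -, hv⟩ := Finset.mem_biUnion.1 hv
      rwa [← hq, (hLc hv).2]
    exact (Finset.card_le_card this).trans ((hc q).le.trans (min_le_right _ _))
  · rw [Finset.card_biUnion]
    · exact (Finset.sum_congr rfl fun q _ => (hc q).symm).le
    · intro q _ q' _ hne
      exact Finset.disjoint_left.2 fun v hv hv' => hne ((hLc hv).2.symm.trans (hLc hv').2)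

theorem label_le (w t : ℕ) : I.label w t ≤ I.n := by
  rw [label]; split_ifs <;> omega

/-- If the clique of `r` joins block `a r`, or is a component of its own if `a r = 0`, then the
available vertices, reduced to `m` vertices in every component, can be kept. -/
theorem exists_cert (hI : I.IsGraph) {w : ℕ} (hw : I.Compat w) (m : ℕ) (a : ℕ → ℕ) :
    ∃ K, I.Cert m K ∧
      ∑ j ∈ Finset.range I.n,
          min (I.blk w (j + 1) + ∑ r ∈ I.reps with a r = j + 1, I.av w (j + 1) r) m +
        ∑ r ∈ I.reps with a r = 0, min (I.av w 0 r) m ≤ K.card := by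
  classical
  obtain ⟨rp, hrp⟩ : ∃ rp : ℕ → ℕ, ∀ v, v < I.n → ¬ I.InD v → rp v ∈ I.reps ∧ I.Mem (rp v) v := by
    have : ∀ v, ∃ r, v < I.n → ¬ I.InD v → r ∈ I.reps ∧ I.Mem r v := by
      intro v
      by_cases h : v < I.n ∧ ¬ I.InD v
      · obtain ⟨r, h1, h2⟩ := exists_rep h.1 h.2
        exact ⟨r, fun _ _ => ⟨h1, h2⟩⟩
      · exact ⟨0, fun h1 h2 => absurd ⟨h1, h2⟩ h⟩
    choose rp hrp using this
    exact ⟨rp, hrp⟩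
  have hrp' : ∀ {r v}, v < I.n → r ∈ I.reps → I.Mem r v → rp v = r := fun hv hr h =>
    rep_unique hI (hrp _ hv h.1).1 hr (hrp _ hv h.1).2 h
  -- the colours `1, …, n` stand for the blocks, the others for separated cliques
  let c : ℕ → ℕ := fun v => if I.InD v then I.lab w v else
    if a (rp v) = 0 then I.n + 1 + rp v else a (rp v)
  let E : Finset ℕ := below (fun v => (I.InD v ∧ I.lab w v ≠ 0) ∨
    (¬ I.InD v ∧ I.Avail w (a (rp v)) v)) I.n
  obtain ⟨K, hKE, hm, hK⟩ := exists_truncation E (Finset.range (I.n + 1 + I.n)) c m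
  have hDV : ∀ u v, u < I.n → v < I.n → I.InD u → I.lab w u ≠ 0 → ¬ I.InD v →
      I.Avail w (a (rp v)) v → I.Adj u v → c u = c v := by
    intro u v hu hv huD hu0 hvD hav h
    have := (hav u hu huD h).resolve_left hu0
    simp only [c, if_pos huD, if_neg hvD]
    rw [if_neg (by omega), this]
  refine ⟨K, ⟨fun v hv => Finset.mem_range.2 (mem_below.1 (hKE hv)).1, c, ?_, hm⟩, ?_⟩
  · intro u hu v hv h
    obtain ⟨hun, hu⟩ := mem_below.1 (hKE hu)
    obtain ⟨hvn, hv⟩ := mem_below.1 (hKE hv)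
    rcases hu with ⟨huD, hu⟩ | ⟨huD, hu⟩ <;> rcases hv with ⟨hvD, hv⟩ | ⟨hvD, hv⟩
    · simp only [c, if_pos huD, if_pos hvD]
      have := hw u hun v hvn huD hvD h
      tauto
    · exact hDV u v hun hvn huD hu hvD hv h
    · exact (hDV v u hvn hun hvD hv huD hu (hI.symm h)).symm
    · have h1 := hrp u hun huD
      have h2 := hrp' hvn h1.1 (mem_of_adj h1.1 h1.2 hvD h)
      simp only [c, if_neg huD, if_neg hvD, h2]
  · refine le_trans ?_ hK
    rw [Finset.sum_range_add, Finset.sum_range_succ']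
    refine Nat.add_le_add (le_trans ?_ (Nat.le_add_right _ _)) ?_
    · refine Finset.sum_le_sum fun j hj => min_le_min_right m ?_
      have hS : (I.reps.filter fun r => a r = j + 1) ⊆ I.reps := Finset.filter_subset _ _
      rw [show (∑ r ∈ I.reps with a r = j + 1, I.av w (j + 1) r) = _ from
        sum_countTo_mem hI hS fun r v => I.Avail w (j + 1) v, blk, countTo_eq_card,
        ← Finset.card_union_of_disjoint]
      · refine Finset.card_le_card fun v hv => ?_
        rcases Finset.mem_union.1 hv with hv | hv
        · obtain ⟨hvn, hvD, hv⟩ := mem_below.1 hv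
          refine Finset.mem_filter.2 ⟨mem_below.2 ⟨hvn, Or.inl ⟨hvD, by omega⟩⟩, ?_⟩
          simp only [c, if_pos hvD, hv]
        · obtain ⟨hvn, r, hr, hrv, hav⟩ := mem_below.1 hv
          obtain ⟨hr, har⟩ := Finset.mem_filter.1 hr
          have h1 := hrp' hvn hr hrv
          refine Finset.mem_filter.2 ⟨mem_below.2 ⟨hvn, Or.inr ⟨hrv.1, ?_⟩⟩, ?_⟩
          · rwa [h1, har]
          · simp only [c, if_neg hrv.1, h1, har]
            simp
      · refine Finset.disjoint_left.2 fun v hv hv' => ?_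
        obtain ⟨_, _, _, h, _⟩ := mem_below.1 hv'
        exact h.1 (mem_below.1 hv).2.1
    · refine le_trans (Finset.sum_le_sum fun r hr => ?_)
        (Finset.sum_le_sum_of_subset (s := I.reps.filter fun r => a r = 0) fun r hr =>
          Finset.mem_range.2 (mem_below.1 (Finset.mem_filter.1 hr).1).1)
      obtain ⟨hr, har⟩ := Finset.mem_filter.1 hr
      rw [av, countTo_eq_card]
      refine min_le_min_right m (Finset.card_le_card fun v hv => ?_)
      obtain ⟨hvn, hrv, hav⟩ := mem_below.1 hv
      have h1 := hrp' hvn hr hrv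
      refine Finset.mem_filter.2 ⟨mem_below.2 ⟨hvn, Or.inr ⟨hrv.1, by rwa [h1, har]⟩⟩, ?_⟩
      simp only [c, if_neg hrv.1, h1, har, if_true]

theorem freeBlock_le (w r : ℕ) : I.freeBlock w r ≤ I.n := by
  rw [freeBlock]
  refine iter_induction (fun x => x ≤ I.n) (Nat.zero_le _) fun i hi acc h => ?_
  split_ifs <;> omega

theorem joins_le (w w' m r : ℕ) : I.joins w w' m r ≤ I.n := by
  rw [joins]
  split_ifs
  exacts [label_le _ _, freeBlock_le _ _]

/-- The value of a guess is attained by a set of kept vertices. -/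
theorem exists_cert_of_guess (hI : I.IsGraph) {w : ℕ} (hw : I.Compat w) (w' : ℕ) {m : ℕ}
    (hmn : m ≤ I.n) :
    ∃ K, I.Cert m K ∧ sumTo (I.n + 1) (I.part w w' m) ≤ K.card := by
  classical
  have h := fun j => exists_knap_le (fun r => I.IsRep r ∧ I.joins w w' m r = j)
    (fun r => min (I.av w 0 r) m) (I.av w j) I.n (if j = 0 then 0 else m - I.blk w j)
  choose X hX hle using h
  let a : ℕ → ℕ := fun r => if r ∈ X (I.joins w w' m r) then 0 else I.joins w w' m r
  obtain ⟨K, hK, hcard⟩ := exists_cert hI hw m a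
  refine ⟨K, hK, le_trans ?_ hcard⟩
  let S : Finset ℕ := I.reps.filter fun r => a r = 0
  have hXj : ∀ j, ∑ r ∈ X j, min (I.av w 0 r) m
      ≤ ∑ r ∈ S with I.joins w w' m r = j, min (I.av w 0 r) m := fun j => by
    refine Finset.sum_le_sum_of_subset fun r hr => ?_
    obtain ⟨h1, h2⟩ := mem_assigned.1 (hX j hr)
    have : a r = 0 := if_pos (by rwa [h2])
    simp [S, h1, h2, this]
  have hdiff : ∀ j, ∑ r ∈ I.assigned w w' m (j + 1) \ X (j + 1), I.av w (j + 1) r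
      ≤ ∑ r ∈ I.reps with a r = j + 1, I.av w (j + 1) r := fun j => by
    refine Finset.sum_le_sum_of_subset fun r hr => ?_
    obtain ⟨hr, hr'⟩ := Finset.mem_sdiff.1 hr
    obtain ⟨h1, h2⟩ := mem_assigned.1 hr
    have : a r = j + 1 := by
      simp only [a, h2, if_neg hr']
    simp [h1, this]
  have hfib : ∑ j ∈ Finset.range (I.n + 1), ∑ r ∈ S with I.joins w w' m r = j,
      min (I.av w 0 r) m = ∑ r ∈ S, min (I.av w 0 r) m :=
    Finset.sum_fiberwise_of_maps_to
      (fun r _ => Finset.mem_range.2 (Nat.lt_succ_of_le (I.joins_le w w' m r))) _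
  rw [Finset.sum_range_succ'] at hfib
  have h0 : I.part w w' m 0 ≤ ∑ r ∈ S with I.joins w w' m r = 0, min (I.av w 0 r) m := by
    have := hle 0
    rw [if_pos rfl, min_eq_right (Nat.zero_le _), add_zero] at this
    rw [part, if_pos rfl, get_table hI _ _ _ _ (Nat.zero_le _)]
    exact this.trans (hXj 0)
  rw [sumTo, Finset.sum_range_succ']
  have hj : ∀ j ∈ Finset.range I.n, I.part w w' m (j + 1) ≤
      min (I.blk w (j + 1) + ∑ r ∈ I.reps with a r = j + 1, I.av w (j + 1) r) m +
        ∑ r ∈ S with I.joins w w' m r = j + 1, min (I.av w 0 r) m := by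
    intro j _
    have h1 := hle (j + 1)
    have h2 := hXj (j + 1)
    have h3 := hdiff j
    rw [assigned] at h3
    rw [if_neg (Nat.succ_ne_zero j)] at h1
    rw [part, if_neg (Nat.succ_ne_zero j), get_table hI _ _ _ _ (by omega)]
    omega
  have := Finset.sum_le_sum hj
  rw [Finset.sum_add_distrib] at this
  change _ ≤ _ + ∑ r ∈ S, min (I.av w 0 r) m
  omega

/-! ### From a set of kept vertices to labels -/

/-- If at most `d` vertices satisfy `P`, then any labels from `0` to `d` on these vertices are
those of some guess, where the labels of a guess are used up in the order of the vertices. -/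
theorem exists_label {P : ℕ → Prop} (hP : countTo I.n P ≤ I.dNum) (l : ℕ → ℕ)
    (hl : ∀ u, l u ≤ I.dNum) : ∃ w < I.numGuesses, ∀ u < I.n, P u →
      I.label w (countTo I.n fun v => v < u ∧ P v) = l u := by
  classical
  have hlt : ∀ u < I.n, P u → (countTo I.n fun v => v < u ∧ P v) < countTo I.n P := by
    intro u hu hPu
    exact countTo_lt_countTo (fun v h => h.2) hu (fun h => lt_irrefl _ h.1) hPu
  have hmono : ∀ u u', u < I.n → P u → u < u' →
      (countTo I.n fun v => v < u ∧ P v) < countTo I.n fun v => v < u' ∧ P v := by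
    intro u u' hu hPu huu'
    exact countTo_lt_countTo (fun v h => ⟨h.1.trans huu', h.2⟩) hu (fun h => lt_irrefl _ h.1)
      ⟨huu', hPu⟩
  let δ : ℕ → ℕ := fun t =>
    if h : ∃ u < I.n, P u ∧ (countTo I.n fun v => v < u ∧ P v) = t then l h.choose else 0
  have hδ : ∀ t, δ t < 2 ^ I.dNum := fun t => by
    refine lt_of_le_of_lt ?_ (Nat.lt_two_pow_self (n := I.dNum))
    simp only [δ]
    split_ifs
    exacts [hl _, Nat.zero_le _]
  obtain ⟨w, hw, hdig⟩ := exists_digits (2 ^ I.dNum) I.dNum δ hδ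
  refine ⟨w, by rwa [I.numGuesses_eq], fun u hu hPu => ?_⟩
  have hr := (hlt u hu hPu).trans_le hP
  have hd := I.dNum_le
  have : I.digit I.dNum w (countTo I.n fun v => v < u ∧ P v) = l u := by
    rw [I.digit_eq hd (hr.le.trans hd), hdig _ hr]
    have hex : ∃ u' < I.n, P u' ∧ (countTo I.n fun v => v < u' ∧ P v)
        = countTo I.n fun v => v < u ∧ P v := ⟨u, hu, hPu, rfl⟩
    simp only [δ, dif_pos hex]
    obtain ⟨h1, h2, h3⟩ := hex.choose_spec
    rcases lt_trichotomy hex.choose u with h | h | h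
    · have := hmono _ _ h1 h2 h; omega
    · rw [h]
    · have := hmono _ _ hu hPu h; omega
  have := hl u
  rw [label, if_pos (by omega)]
  assumption

theorem freeBlock_spec {w r : ℕ} (h : ∃ j < I.n + 1, I.av w j r = I.sz r) :
    I.av w (I.freeBlock w r) r = I.sz r := by
  classical
  have key : ∀ k, (∃ j < k, I.av w j r = I.sz r) →
      I.av w (iter k 0 fun j acc => if I.av w j r = I.sz r then j else acc) r = I.sz r := by
    intro k
    induction k with
    | zero => rintro ⟨j, hj, -⟩; exact absurd hj (Nat.not_lt_zero j)
    | succ k ih =>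
      rintro ⟨j, hj, h⟩
      rw [iter_succ]
      split_ifs with hk
      · exact hk
      · refine ih ⟨j, lt_of_le_of_ne (Nat.le_of_lt_succ hj) ?_, h⟩
        rintro rfl; exact hk h
  rw [freeBlock]
  convert key _ h

theorem avail_of_av_eq {w j r v : ℕ} (h : I.av w j r = I.sz r) (hv : v < I.n) (hr : I.Mem r v) :
    I.Avail w j v := by
  rw [av, sz, countTo_eq_card, countTo_eq_card] at h
  have hsub : below (fun v => I.Mem r v ∧ I.Avail w j v) I.n ⊆ below (I.Mem r) I.n :=
    fun v hv => mem_below.2 ⟨(mem_below.1 hv).1, (mem_below.1 hv).2.1⟩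
  have := Finset.eq_of_subset_of_card_le hsub h.ge
  have hv' : v ∈ below (I.Mem r) I.n := mem_below.2 ⟨hv, hr⟩
  rw [← this] at hv'
  exact (mem_below.1 hv').2.2

end RAM.Inst

namespace RAM.Inst

variable {I : Inst}

/-- Deleting the modulator and reducing every clique to `m` vertices is always possible. -/
theorem exists_cert_min_sz (hI : I.IsGraph) (m : ℕ) :
    ∃ K, I.Cert m K ∧ ∑ r ∈ I.reps, min (I.sz r) m ≤ K.card := by
  have h0 : ∀ u, I.lab 0 u = 0 := by
    intro u
    have : (countTo I.n fun v => v < u ∧ I.InD v) ≤ I.n := countTo_le _ _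
    rw [lab, label, I.digit_eq I.dNum_le this]
    simp
  have hav : ∀ r, I.av 0 0 r = I.sz r := by
    intro r
    refine le_antisymm (av_le_sz _ _ _) (countTo_mono fun v _ h => ⟨h, fun u _ _ _ => ?_⟩)
    exact Or.inl (h0 u)
  obtain ⟨K, hK, h⟩ := exists_cert hI (w := 0) (fun u _ v _ _ _ _ => Or.inl (h0 u)) m fun _ => 0
  refine ⟨K, hK, ?_⟩
  simp only [hav, Finset.filter_true] at h
  omega

/-- A maximum set of kept vertices is found with some guess. The guess describes which vertices
of the modulator are kept and which have the same colour, and, for the cliques that lose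
vertices anyway, the block that they join; the latter cliques are at most as many as the vertices
of the modulator, since deleting the modulator instead would keep one more vertex of each. -/
theorem exists_guess (hI : I.IsGraph) {m : ℕ} (hmn : m ≤ I.n)
    {K : Finset ℕ} (hK : I.Cert m K)
    (hmax : ∀ K', I.Cert m K' → K'.card ≤ K.card) : ∃ w < I.numGuesses, ∃ w' < I.numGuesses,
      I.Compat w ∧ K.card ≤ sumTo (I.n + 1) (I.part w w' m) := by
  classical
  obtain ⟨hKn, col, hcol, hm⟩ := hK
  have hKlt : ∀ {v}, v ∈ K → v < I.n := fun hv => Finset.mem_range.1 (hKn hv)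
  have hclass : ∀ T ⊆ K, (∀ x ∈ T, ∀ y ∈ T, col x = col y) → T.card ≤ m := by
    intro T hT hc
    rcases T.eq_empty_or_nonempty with rfl | ⟨x, hx⟩
    · simp
    · refine (Finset.card_le_card fun y hy => ?_).trans (hm (col x))
      exact Finset.mem_filter.2 ⟨hT hy, hc y hy x hx⟩
  -- the labels of the modulator
  let DK : Finset ℕ := K.filter I.InD
  have hDK : DK.card ≤ I.dNum := Finset.card_le_card fun u hu =>
    mem_below.2 ⟨hKlt (Finset.mem_filter.1 hu).1, (Finset.mem_filter.1 hu).2⟩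
  let l : ℕ → ℕ := fun u => if u ∈ DK then 1 + ((DK.image col).filter (· < col u)).card else 0
  have hl : ∀ u, l u ≤ I.dNum := by
    intro u
    simp only [l]
    split_ifs with hu
    · have h1 : ((DK.image col).filter (· < col u)).card < (DK.image col).card :=
        Finset.card_lt_card (Finset.filter_ssubset.2
          ⟨col u, Finset.mem_image_of_mem _ hu, lt_irrefl _⟩)
      have h2 : (DK.image col).card ≤ DK.card := Finset.card_image_le
      omega
    · exact Nat.zero_le _
  have hlt : ∀ u ∈ DK, ∀ u' ∈ DK, col u < col u' → l u < l u' := by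
    intro u hu u' hu' h
    simp only [l, if_pos hu, if_pos hu']
    refine Nat.add_lt_add_left (Finset.card_lt_card ((Finset.ssubset_iff_of_subset ?_).2
      ⟨col u, Finset.mem_filter.2 ⟨Finset.mem_image_of_mem _ hu, h⟩, by simp⟩)) 1
    intro q hq
    obtain ⟨h1, h2⟩ := Finset.mem_filter.1 hq
    exact Finset.mem_filter.2 ⟨h1, h2.trans h⟩
  obtain ⟨w, hw, hlab⟩ := exists_label (I := I) (P := I.InD) le_rfl l hl
  replace hlab : ∀ u < I.n, I.InD u → I.lab w u = l u := hlab
  have hlab0 : ∀ u < I.n, I.InD u → (I.lab w u ≠ 0 ↔ u ∈ K) := by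
    intro u hu huD
    rw [hlab u hu huD]
    by_cases h : u ∈ K
    · simp [l, DK, h, huD]
    · simp [l, DK, h]
  have hlabcol : ∀ u ∈ K, ∀ u' ∈ K, I.InD u → I.InD u' →
      (I.lab w u = I.lab w u' ↔ col u = col u') := by
    intro u hu u' hu' huD huD'
    rw [hlab u (hKlt hu) huD, hlab u' (hKlt hu') huD']
    have h1 : u ∈ DK := Finset.mem_filter.2 ⟨hu, huD⟩
    have h2 : u' ∈ DK := Finset.mem_filter.2 ⟨hu', huD'⟩
    constructor
    · intro h
      rcases lt_trichotomy (col u) (col u') with h' | h' | h'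
      · have := hlt u h1 u' h2 h'; omega
      · exact h'
      · have := hlt u' h2 u h1 h'; omega
    · intro h
      simp only [l, if_pos h1, if_pos h2, h]
  have hcompat : I.Compat w := by
    intro u hu v hv huD hvD hadj
    by_cases huK : u ∈ K
    · by_cases hvK : v ∈ K
      · exact Or.inr (Or.inr ((hlabcol u huK v hvK huD hvD).2 (hcol u huK v hvK hadj)))
      · exact Or.inr (Or.inl (not_not.1 (mt (hlab0 v hv hvD).1 hvK)))
    · exact Or.inl (not_not.1 (mt (hlab0 u hu huD).1 huK))
  -- the block `b r` that the clique of `r` joins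
  let b : ℕ → ℕ := fun r =>
    if h : ∃ u ∈ K, I.InD u ∧ ∃ v ∈ K, I.Mem r v ∧ col u = col v then I.lab w h.choose else 0
  have hsame : ∀ r ∈ I.reps, ∀ v ∈ K, ∀ v' ∈ K, I.Mem r v → I.Mem r v' → col v = col v' := by
    intro r hr v hv v' hv' h h'
    by_cases hne : v = v'
    · rw [hne]
    · exact hcol v hv v' hv' (mem_adj hI hr h h' hne)
  have hbav : ∀ r ∈ I.reps, ∀ v ∈ K, I.Mem r v → I.Avail w (b r) v := by
    intro r hr v hv hrv u hu huD hadj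
    by_cases huK : u ∈ K
    · right
      have hex : ∃ u ∈ K, I.InD u ∧ ∃ v ∈ K, I.Mem r v ∧ col u = col v :=
        ⟨u, huK, huD, v, hv, hrv, hcol u huK v hv hadj⟩
      simp only [b, dif_pos hex]
      obtain ⟨h1, h2, v', h3, h4, h5⟩ := hex.choose_spec
      rw [hlabcol u huK _ h1 huD h2, h5, hcol u huK v hv hadj]
      exact hsame r hr v hv v' h3 hrv h4
    · exact Or.inl (not_not.1 (mt (hlab0 u hu huD).1 huK))
  have hbne : ∀ r, b r ≠ 0 → ∃ u ∈ K, I.InD u ∧ I.lab w u = b r ∧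
      ∃ v ∈ K, I.Mem r v ∧ col u = col v := by
    intro r h
    by_cases hex : ∃ u ∈ K, I.InD u ∧ ∃ v ∈ K, I.Mem r v ∧ col u = col v
    · obtain ⟨h1, h2, h3⟩ := hex.choose_spec
      exact ⟨hex.choose, h1, h2, by simp only [b, dif_pos hex], h3⟩
    · exact absurd (dif_neg hex) h
  have hbd : ∀ r, b r ≤ I.dNum := by
    intro r
    by_cases h : b r = 0
    · omega
    · obtain ⟨u, huK, huD, hu, -⟩ := hbne r h
      rw [← hu, hlab u (hKlt huK) huD]
      exact hl u
  -- the number `k r` of kept vertices of the clique of `r`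
  let k : ℕ → ℕ := fun r => countTo I.n fun v => I.Mem r v ∧ v ∈ K
  have hkm : ∀ r ∈ I.reps, k r ≤ m := by
    intro r hr
    refine hclass _ (fun v hv => (mem_below.1 hv).2.2) fun x hx y hy => ?_
    exact hsame r hr x (mem_below.1 hx).2.2 y (mem_below.1 hy).2.2 (mem_below.1 hx).2.1
      (mem_below.1 hy).2.1
  have hkav : ∀ r j, (∀ v ∈ K, I.Mem r v → I.Avail w j v) → k r ≤ I.av w j r := by
    intro r j h
    exact countTo_mono fun v _ hv => ⟨hv.1, h v hv.2 hv.1⟩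
  have hksum : ∑ r ∈ I.reps, k r + DK.card = K.card := by
    rw [show ∑ r ∈ I.reps, k r = _ from sum_countTo_mem hI (Finset.Subset.refl _) fun _ v => v ∈ K,
      add_comm, ← Finset.card_filter_add_card_filter_not (s := K) I.InD]
    congr 2
    ext v
    simp only [mem_below, Finset.mem_filter]
    constructor
    · rintro ⟨-, r, -, hrv, hv⟩
      exact ⟨hv, hrv.1⟩
    · rintro ⟨hv, hvD⟩
      obtain ⟨r, hr, hrv⟩ := exists_rep (hKlt hv) hvD
      exact ⟨hKlt hv, r, hr, hrv, hv⟩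
  have hmulti : ∀ r ∈ I.reps, I.Multi w m r → k r + 1 ≤ min (I.sz r) m := by
    rintro r hr ⟨-, h0, hne⟩
    have h1 := hkav r (b r) (hbav r hr)
    have h2 := av_le_sz (I := I) w (b r) r
    have h3 := hne (b r) (Nat.lt_succ_of_le ((hbd r).trans I.dNum_le))
    refine le_min (by omega) ?_
    by_cases hb : b r = 0
    · rw [hb] at h1; omega
    · obtain ⟨u, huK, huD, -, v, hvK, hv, huv⟩ := hbne r hb
      have hu : u ∉ below (fun v => I.Mem r v ∧ v ∈ K) I.n := fun h => (mem_below.1 h).2.1.1 huD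
      rw [show k r + 1 = _ from (Finset.card_insert_of_notMem hu).symm]
      have hcu : ∀ x ∈ insert u (below (fun v => I.Mem r v ∧ v ∈ K) I.n), col x = col v := by
        intro x hx
        rcases Finset.mem_insert.1 hx with rfl | hx
        · exact huv
        · exact hsame r hr x (mem_below.1 hx).2.2 v hvK (mem_below.1 hx).2.1 hv
      refine hclass _ (Finset.insert_subset huK fun v hv => (mem_below.1 hv).2.2) ?_
      intro x hx y hy
      rw [hcu x hx, hcu y hy]
  have hcount : countTo I.n (I.Multi w m) ≤ I.dNum := by
    obtain ⟨K', hK', hle⟩ := exists_cert_min_sz hI m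
    have h1 : ∑ r ∈ I.reps, (k r + if I.Multi w m r then 1 else 0)
        ≤ ∑ r ∈ I.reps, min (I.sz r) m := by
      refine Finset.sum_le_sum fun r hr => ?_
      split_ifs with h
      · exact hmulti r hr h
      · exact le_min (countTo_mono fun v _ h => h.1) (hkm r hr)
    have h2 : countTo I.n (I.Multi w m) = ∑ r ∈ I.reps, if I.Multi w m r then 1 else 0 := by
      rw [← Finset.card_filter, countTo_eq_card]
      congr 1
      ext r
      simp only [reps, mem_below, Finset.mem_filter]
      exact ⟨fun h => ⟨⟨h.1, h.2.1⟩, h.2⟩, fun h => ⟨h.1.1, h.2⟩⟩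
    rw [Finset.sum_add_distrib] at h1
    have := hmax K' hK'
    omega
  obtain ⟨w', hw', hlab'⟩ := exists_label (I := I) hcount b hbd
  have hjoins : ∀ r ∈ I.reps, I.Multi w m r → I.joins w w' m r = b r := by
    intro r hr h
    rw [joins, if_pos h]
    exact hlab' r (mem_below.1 hr).1 h
  -- cliques that do not join the assigned block lose nothing by being separated
  have hsep : ∀ r ∈ I.reps, (b r ≠ I.joins w w' m r ∨ b r = 0) → k r ≤ min (I.av w 0 r) m := by
    intro r hr h
    refine le_min ?_ (hkm r hr)
    by_cases hb : b r = 0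
    · exact hkav r 0 (hb ▸ hbav r hr)
    · have hbj := h.resolve_right hb
      have hnm : ¬ I.Multi w m r := fun h => hbj (hjoins r hr h).symm
      by_cases h0 : I.av w 0 r < m
      · have hex : ∃ j < I.n + 1, I.av w j r = I.sz r := by
          by_contra hex
          exact hnm ⟨(mem_below.1 hr).2, h0, fun j hj h => hex ⟨j, hj, h⟩⟩
        have hfree := freeBlock_spec hex
        rw [joins, if_neg hnm] at hbj
        refine hkav r 0 fun v hv hrv u hu huD hadj => ?_
        have h1 := hbav r hr v hv hrv u hu huD hadj
        have h2 := avail_of_av_eq hfree (hKlt hv) hrv u hu huD hadj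
        omega
      · exact (hkm r hr).trans (not_lt.1 h0)
  refine ⟨w, hw, w', hw', hcompat, ?_⟩
  have hasg : ∀ j, I.assigned w w' m j = I.reps.filter fun r => I.joins w w' m r = j := fun j => by
    ext r; rw [mem_assigned, Finset.mem_filter]
  have hpart0 : ∑ r ∈ I.assigned w w' m 0, k r ≤ I.part w w' m 0 := by
    rw [part, if_pos rfl, get_table hI _ _ _ _ (Nat.zero_le _)]
    refine le_trans ?_ (le_knap 0 (Finset.Subset.refl _))
    refine (Finset.sum_le_sum fun r hr => ?_).trans (Nat.le_add_right _ _)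
    obtain ⟨h1, h2⟩ := mem_assigned.1 hr
    refine hsep r h1 ?_
    rw [h2]; tauto
  have hpart : ∀ j ∈ Finset.range I.n, I.blk w (j + 1) + ∑ r ∈ I.assigned w w' m (j + 1), k r
      ≤ I.part w w' m (j + 1) := by
    intro j _
    let X := (I.assigned w w' m (j + 1)).filter fun r => b r ≠ j + 1
    have hX : X ⊆ I.assigned w w' m (j + 1) := Finset.filter_subset _ _
    have hle : ∑ r ∈ X, min (I.av w 0 r) m +
        min (∑ r ∈ I.assigned w w' m (j + 1) \ X, I.av w (j + 1) r) (m - I.blk w (j + 1)) ≤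
        knap (fun r => I.IsRep r ∧ I.joins w w' m r = j + 1) (fun r => min (I.av w 0 r) m)
          (I.av w (j + 1)) I.n (m - I.blk w (j + 1)) := le_knap _ hX
    rw [part, if_neg (Nat.succ_ne_zero j), get_table hI _ _ _ _ (by omega)]
    have h1 : ∑ r ∈ X, k r ≤ ∑ r ∈ X, min (I.av w 0 r) m := by
      refine Finset.sum_le_sum fun r hr => ?_
      obtain ⟨hr, hb⟩ := Finset.mem_filter.1 hr
      obtain ⟨hr, hj⟩ := mem_assigned.1 hr
      exact hsep r hr (Or.inl (hj ▸ hb))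
    have hY : ∀ {r}, r ∈ I.assigned w w' m (j + 1) \ X → r ∈ I.reps ∧ b r = j + 1 := by
      intro r hr
      obtain ⟨hr, hrX⟩ := Finset.mem_sdiff.1 hr
      refine ⟨(mem_assigned.1 hr).1, ?_⟩
      by_contra hb
      exact hrX (Finset.mem_filter.2 ⟨hr, hb⟩)
    have h2 : ∑ r ∈ I.assigned w w' m (j + 1) \ X, k r
        ≤ ∑ r ∈ I.assigned w w' m (j + 1) \ X, I.av w (j + 1) r :=
      Finset.sum_le_sum fun r hr => hkav r _ ((hY hr).2 ▸ hbav r (hY hr).1)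
    have h3 := Finset.sum_sdiff (f := k) hX
    -- the vertices kept in block `j + 1` and in the cliques that join it have the same colour
    have h4 : I.blk w (j + 1) + ∑ r ∈ I.assigned w w' m (j + 1) \ X, k r ≤ m := by
      rw [show ∑ r ∈ I.assigned w w' m (j + 1) \ X, k r = _ from
        sum_countTo_mem hI (fun r hr => (hY hr).1) fun _ v => v ∈ K, blk, countTo_eq_card,
        ← Finset.card_union_of_disjoint]
      · have hwit : ∀ x ∈ below (fun u => I.InD u ∧ I.lab w u = j + 1) I.n ∪
            below (fun v => ∃ r ∈ I.assigned w w' m (j + 1) \ X, I.Mem r v ∧ v ∈ K) I.n,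
            x ∈ K ∧ ∃ u ∈ K, I.InD u ∧ I.lab w u = j + 1 ∧ col u = col x := by
          intro x hx
          rcases Finset.mem_union.1 hx with hx | hx
          · obtain ⟨hxn, hxD, hx⟩ := mem_below.1 hx
            have hxK := (hlab0 x hxn hxD).1 (by omega)
            exact ⟨hxK, x, hxK, hxD, hx, rfl⟩
          · obtain ⟨hxn, r, hr, hrx, hxK⟩ := mem_below.1 hx
            obtain ⟨hr, hb⟩ := hY hr
            obtain ⟨u, huK, huD, hu, v, hvK, hv, huv⟩ := hbne r (by omega)
            exact ⟨hxK, u, huK, huD, hu.trans hb, huv.trans (hsame r hr v hvK x hxK hv hrx)⟩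
        refine hclass _ (fun x hx => (hwit x hx).1) fun x hx y hy => ?_
        obtain ⟨-, u, huK, huD, hu, hux⟩ := hwit x hx
        obtain ⟨-, u', huK', huD', hu', huy⟩ := hwit y hy
        rw [← hux, ← huy]
        exact (hlabcol u huK u' huK' huD huD').1 (hu.trans hu'.symm)
      · refine Finset.disjoint_left.2 fun v hv hv' => ?_
        obtain ⟨_, _, _, h, _⟩ := mem_below.1 hv'
        exact h.1 (mem_below.1 hv).2.1
    omega
  have hDKsum : DK.card ≤ ∑ j ∈ Finset.range I.n, I.blk w (j + 1) := by
    have h1 : DK.card = ∑ j ∈ Finset.range (I.n + 1), (DK.filter fun u => I.lab w u = j).card :=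
      Finset.card_eq_sum_card_fiberwise fun u _ =>
        Finset.mem_coe.2 (Finset.mem_range.2 (Nat.lt_succ_of_le (label_le _ _)))
    have h2 : (DK.filter fun u => I.lab w u = 0).card = 0 := by
      refine Finset.card_eq_zero.2 (Finset.filter_eq_empty_iff.2 fun u hu => ?_)
      obtain ⟨huK, huD⟩ := Finset.mem_filter.1 hu
      exact (hlab0 u (hKlt huK) huD).2 huK
    rw [Finset.sum_range_succ', h2, add_zero] at h1
    rw [h1]
    refine Finset.sum_le_sum fun j _ => ?_
    rw [blk, countTo_eq_card]
    refine Finset.card_le_card fun u hu => ?_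
    obtain ⟨hu, hj⟩ := Finset.mem_filter.1 hu
    obtain ⟨huK, huD⟩ := Finset.mem_filter.1 hu
    exact mem_below.2 ⟨hKlt huK, huD, hj⟩
  have hfib : ∑ j ∈ Finset.range (I.n + 1), ∑ r ∈ I.assigned w w' m j, k r = ∑ r ∈ I.reps, k r := by
    simp only [hasg]
    exact Finset.sum_fiberwise_of_maps_to
      (fun r _ => Finset.mem_range.2 (Nat.lt_succ_of_le (I.joins_le w w' m r))) _
  rw [Finset.sum_range_succ'] at hfib
  rw [sumTo, Finset.sum_range_succ']
  have := Finset.sum_le_sum hpart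
  rw [Finset.sum_add_distrib] at this
  omega

end RAM.Inst

namespace RAM.Inst

variable {I : Inst}

/-! ### Correctness of the test -/

/-- All guesses being tried, the test succeeds iff some set of vertices can be kept at the
required cost; among the sets for the same threshold a maximum one is then found. -/
theorem accept_iff (hI : I.IsGraph) (hg : I.guesses = I.numGuesses) :
    I.Accept ↔ ∃ m ≤ I.n, ∃ K, I.Cert m K ∧ I.n + m ≤ I.bound + K.card := by
  classical
  constructor
  · rintro ⟨m, hm, w, -, w', -, hw, h⟩
    obtain ⟨K, hK, hle⟩ := exists_cert_of_guess hI hw w' (Nat.le_of_lt_succ hm)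
    exact ⟨m, Nat.le_of_lt_succ hm, K, hK, by omega⟩
  · rintro ⟨m, hm, K, hK, h⟩
    let F := (Finset.range I.n).powerset.filter (I.Cert m)
    have hF : ∀ {L}, I.Cert m L → L ∈ F := fun hL =>
      Finset.mem_filter.2 ⟨Finset.mem_powerset.2 hL.1, hL⟩
    obtain ⟨L, hL, hmax⟩ := F.exists_max_image Finset.card ⟨K, hF hK⟩
    obtain ⟨w, hw, w', hw', hc, hle⟩ := exists_guess hI hm (Finset.mem_filter.1 hL).2
      fun K' hK' => hmax K' (hF hK')
    have := hmax K (hF hK)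
    exact ⟨m, Nat.lt_succ_of_le hm, w, by rwa [hg], w', by rwa [hg], hc, by omega⟩

end RAM.Inst

namespace VertexIntegrityInstance

open RAM

/-- The data read off the input state. -/
noncomputable def toInst (x : VertexIntegrityInstance) (W : ℕ) : Inst :=
  ⟨x.n, x.bound, W, x.input.mem⟩

theorem adj_toInst (x : VertexIntegrityInstance) (W : ℕ) {i j : ℕ} :
    (x.toInst W).Adj i j ↔ ∃ (hi : i < x.n) (hj : j < x.n), x.graph.Adj ⟨i, hi⟩ ⟨j, hj⟩ := by
  classical
  rw [Inst.Adj, Inst.mulN_eq]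
  change i < x.n ∧ j < x.n ∧ (if ∃ i' j' : Fin x.n, x.graph.Adj i' j' ∧
    x.n * i + j = (i' : ℕ) * x.n + (j' : ℕ) then 1 else 0) ≠ 0 ↔ _
  constructor
  · rintro ⟨hi, hj, h⟩
    obtain ⟨i', j', hadj, he⟩ : ∃ i' j' : Fin x.n, x.graph.Adj i' j' ∧
        x.n * i + j = (i' : ℕ) * x.n + (j' : ℕ) := by
      by_contra h'
      exact h (if_neg h')
    have h1 : j = j' := by
      have := congrArg (· % x.n) he
      simpa [Nat.mul_add_mod, Nat.mul_add_mod', Nat.mod_eq_of_lt hj,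
        Nat.mod_eq_of_lt j'.2] using this
    have h2 : i = i' := by
      rw [h1, mul_comm] at he
      exact Nat.eq_of_mul_eq_mul_right (by omega) (Nat.add_right_cancel he)
    refine ⟨hi, hj, ?_⟩
    convert hadj
  · rintro ⟨hi, hj, h⟩
    refine ⟨hi, hj, ?_⟩
    rw [if_pos ⟨⟨i, hi⟩, ⟨j, hj⟩, h, by simp [mul_comm]⟩]
    exact one_ne_zero

theorem isGraph_toInst (x : VertexIntegrityInstance) (W : ℕ) : (x.toInst W).IsGraph where
  symm h := by
    rw [adj_toInst] at h ⊢
    obtain ⟨hi, hj, h⟩ := h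
    exact ⟨hj, hi, h.symm⟩
  irrefl i h := by
    rw [adj_toInst] at h
    obtain ⟨hi, hj, h⟩ := h
    exact h.ne rfl

/-- The modulator is at most three times larger than a minimum cluster vertex deletion set, as
the latter meets every induced path on three vertices. -/
theorem dNum_toInst_le (x : VertexIntegrityInstance) (W : ℕ) :
    (x.toInst W).dNum ≤ 3 * x.graph.clusterVertexDeletionNumber := by
  classical
  have hne : {k : ℕ | ∃ D : Finset (Fin x.n), x.graph.IsClusterVertexDeletionSet D ∧
      D.card = k}.Nonempty := by
    refine ⟨_, Finset.univ, fun u => ?_, rfl⟩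
    exact absurd u.2 (by simp)
  obtain ⟨D, hD, hcard⟩ := Nat.sInf_mem hne
  rw [SimpleGraph.clusterVertexDeletionNumber, ← hcard]
  rw [← Finset.card_map Fin.valEmbedding]
  refine Inst.dNum_le_three_mul _ _ fun u v w h => ?_
  obtain ⟨huv, hvw, huw, hne⟩ := h
  rw [adj_toInst] at huv hvw huw
  obtain ⟨hu, hv, huv⟩ := huv
  obtain ⟨_, hw, hvw⟩ := hvw
  by_contra hcon
  have hmem : ∀ {i} (hi : i < x.n), i ∈ D.map Fin.valEmbedding ↔ (⟨i, hi⟩ : Fin x.n) ∈ D := by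
    intro i hi
    constructor
    · intro h
      obtain ⟨y, hy, rfl⟩ := Finset.mem_map.1 h
      exact hy
    · exact fun h => Finset.mem_map.2 ⟨_, h, rfl⟩
  rw [hmem hu, hmem hv, hmem hw] at hcon
  push Not at hcon
  obtain ⟨hu', hv', hw'⟩ := hcon
  have key := hD ⟨⟨u, hu⟩, by simpa using hu'⟩ ⟨⟨w, hw⟩, by simpa using hw'⟩ ?_ ?_
  · exact huw ⟨hu, hw, key⟩
  · refine SimpleGraph.Reachable.trans (v := ⟨⟨v, hv⟩, by simpa using hv'⟩) ?_ ?_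
    · exact SimpleGraph.Adj.reachable huv
    · exact SimpleGraph.Adj.reachable hvw
  · simpa using hne

/-- Components are replaced by colours: a deletion set `S` that leaves components of at most `m`
vertices corresponds to the set `K` of the remaining vertices, coloured by their components. -/
theorem vertexIntegrity_le_iff (x : VertexIntegrityInstance) (W : ℕ) :
    x.graph.vertexIntegrity ≤ x.bound ↔ ∃ m ≤ x.n, ∃ K, (x.toInst W).Cert m K ∧
      x.n + m ≤ x.bound + K.card := by
  classical
  constructor
  · intro h
    obtain ⟨S, hS⟩ : ∃ S : Finset (Fin x.n), S.card + x.graph.maxComponentSize S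
        = x.graph.vertexIntegrity :=
      ciInf_mem (fun S : Finset (Fin x.n) => S.card + x.graph.maxComponentSize S)
    let H := x.graph.induce ((S : Set (Fin x.n))ᶜ)
    have hle : ∀ C : H.ConnectedComponent, C.supp.ncard ≤ x.graph.maxComponentSize S :=
      fun C => le_ciSup (f := fun C : H.ConnectedComponent => C.supp.ncard)
        (Set.finite_range _).bddAbove C
    have hmn : x.graph.maxComponentSize S ≤ x.n := by
      refine ciSup_le' fun C => ?_
      refine (Set.ncard_le_card _).trans ?_
      refine (Finite.card_subtype_le _).trans ?_
      simp
    obtain ⟨f, hf⟩ : ∃ f : H.ConnectedComponent → ℕ, Function.Injective f :=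
      Countable.exists_injective_nat _
    have hval : ∀ v ∈ (Sᶜ).map Fin.valEmbedding, ∃ hv : v < x.n, (⟨v, hv⟩ : Fin x.n) ∉ S := by
      intro v hv
      obtain ⟨y, hy, rfl⟩ := Finset.mem_map.1 hv
      exact ⟨y.2, by simpa using hy⟩
    let col : ℕ → ℕ := fun v => if h : ∃ hv : v < x.n, (⟨v, hv⟩ : Fin x.n) ∉ S then
      f (H.connectedComponentMk ⟨⟨v, h.1⟩, by simpa using h.2⟩) else 0
    refine ⟨_, hmn, (Sᶜ).map Fin.valEmbedding, ⟨fun v hv => ?_, col, ?_, ?_⟩, ?_⟩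
    · exact Finset.mem_range.2 (hval v hv).1
    · intro u hu v hv hadj
      have hu' := hval u hu
      have hv' := hval v hv
      rw [adj_toInst] at hadj
      obtain ⟨_, _, hadj⟩ := hadj
      simp only [col, dif_pos hu', dif_pos hv']
      refine congrArg f (SimpleGraph.ConnectedComponent.sound ?_)
      exact SimpleGraph.Adj.reachable hadj
    · intro q
      rcases (((Sᶜ).map Fin.valEmbedding).filter (col · = q)).eq_empty_or_nonempty with h | ⟨v, hv⟩
      · rw [h]; simp
      · obtain ⟨hv, hvq⟩ := Finset.mem_filter.1 hv
        have hv' := hval v hv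
        simp only [col, dif_pos hv'] at hvq
        refine le_trans ?_ (hle (H.connectedComponentMk ⟨⟨v, hv'.1⟩, by simpa using hv'.2⟩))
        rw [← Set.ncard_coe_finset]
        refine (Set.ncard_le_ncard (t := (fun y : ((S : Set (Fin x.n))ᶜ : Set (Fin x.n)) =>
          ((y : Fin x.n) : ℕ)) '' (H.connectedComponentMk _).supp) ?_ (Set.toFinite _)).trans
          (Set.ncard_image_le (Set.toFinite _))
        intro u hu
        obtain ⟨hu, huq⟩ := Finset.mem_filter.1 hu
        have hu' := hval u hu
        simp only [col, dif_pos hu'] at huq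
        exact ⟨⟨⟨u, hu'.1⟩, by simpa using hu'.2⟩, hf (huq.trans hvq.symm), rfl⟩
    · have := Finset.card_compl_add_card S
      rw [Fintype.card_fin] at this
      rw [Finset.card_map]
      omega
  · rintro ⟨m, -, K, ⟨hKn, col, hcol, hm⟩, h⟩
    let S : Finset (Fin x.n) := Finset.univ.filter fun v => (v : ℕ) ∉ K
    have hS : ∀ v : Fin x.n, v ∈ ((S : Set (Fin x.n))ᶜ : Set (Fin x.n)) ↔ (v : ℕ) ∈ K := by
      simp [S]
    have hcard : S.card + K.card = x.n := by
      have h1 : Sᶜ.map Fin.valEmbedding = K := by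
        ext v
        simp only [Finset.mem_map, Fin.valEmbedding_apply]
        constructor
        · rintro ⟨y, hy, rfl⟩
          simpa [S] using hy
        · intro hv
          exact ⟨⟨v, Finset.mem_range.1 (hKn hv)⟩, by simpa [S] using hv, rfl⟩
      have h2 := Finset.card_compl_add_card S
      rw [Fintype.card_fin] at h2
      rw [← h1, Finset.card_map]
      omega
    have hmax : x.graph.maxComponentSize S ≤ m := by
      refine ciSup_le' fun C => ?_
      induction C using SimpleGraph.ConnectedComponent.ind with
      | _ v =>
      have hreach : ∀ u v, (x.graph.induce ((S : Set (Fin x.n))ᶜ)).Reachable u v →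
          col (u : Fin x.n) = col (v : Fin x.n) := by
        rintro u v ⟨p⟩
        induction p with
        | nil => rfl
        | @cons u v w hadj _ ih =>
          refine Eq.trans ?_ ih
          refine hcol _ ((hS _).1 u.2) _ ((hS _).1 v.2) ?_
          rw [adj_toInst]
          exact ⟨_, _, hadj⟩
      refine le_trans ?_ (hm (col (v : Fin x.n)))
      rw [← Set.ncard_coe_finset]
      refine Set.ncard_le_ncard_of_injOn (fun y => ((y : Fin x.n) : ℕ)) ?_ ?_ (Set.toFinite _)
      · intro u hu
        rw [SimpleGraph.ConnectedComponent.mem_supp_iff,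
          SimpleGraph.ConnectedComponent.eq] at hu
        exact Finset.mem_coe.2 (Finset.mem_filter.2 ⟨(hS _).1 u.2, hreach _ _ hu⟩)
      · intro u _ v _ huv
        exact Subtype.ext (Fin.ext huv)
    have : x.graph.vertexIntegrity ≤ S.card + x.graph.maxComponentSize S :=
      ciInf_le (OrderBot.bddBelow _) S
    omega

end VertexIntegrityInstance

/-! ### The program -/

open RAM VertexIntegrityInstance in
theorem mainTheorem1 :
    FixedParameterTractable
      VertexIntegrityInstance.input
      (fun x => x.n)
      (fun x => x.graph.clusterVertexDeletionNumber)
      (fun x => x.graph.vertexIntegrity ≤ x.bound) := by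
  obtain ⟨p, q, e, c, h⟩ := (Inst.cmp_numGuesses (f := fun I : Inst => I) Cmp.id).exists_program
  obtain ⟨-, p', q', e', c', h'⟩ := Inst.cmp_accept (f := fun I : Inst => I) Cmp.id
  -- the input is in the registers `0` and `1`; the bound on the guesses, which is not yet known
  -- in the first phase, is then represented by the empty register `2`
  obtain ⟨h1, h2, h3⟩ := h (0, 1, 2) 3 (by simp [Layout.Below])
  generalize p (0, 1, 2) 3 = p at *
  generalize q (0, 1, 2) 3 = q at *
  generalize e (0, 1, 2) 3 = e at *
  have hb : Layout.Below (X := Inst) ((0, 1, q) : ℕ × ℕ × ℕ) e := by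
    refine ⟨?_, ?_, h2⟩ <;> simp <;> omega
  obtain ⟨h1', h2', h3'⟩ := h' (0, 1, q) e hb
  generalize p' (0, 1, q) e = p' at *
  generalize q' (0, 1, q) e = q' at *
  generalize e' (0, 1, q) e = e' at *
  refine ⟨.seq p (.seq p' (.seq (.const e' 0) (.add 0 q' e'))),
    fun k => ((2 ^ (3 * k)) ^ (3 * k) + 3) ^ (c + c' + 1 + 1 + 1), c + c' + 1 + 1 + 1, ?_, ?_⟩
  · have hpow : Primrec₂ ((· ^ ·) : ℕ → ℕ → ℕ) := Primrec₂.unpaired'.1 Nat.Primrec.pow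
    have h3k : Primrec fun k : ℕ => 3 * k := Primrec.nat_mul.comp (.const 3) .id
    exact (hpow.comp (Primrec.nat_add.comp (hpow.comp (hpow.comp (.const 2) h3k) h3k) (.const 3))
      (.const _)).to_comp
  · intro x
    obtain ⟨t, s, a1, a2, a3, a4, a5⟩ := h3 (x.toInst 0) x.input ⟨rfl, rfl, rfl, rfl⟩
    set W := (x.toInst 0).numGuesses with hW
    obtain ⟨t', s', b1, b2, b3, b4, b5⟩ := h3' (x.toInst W) s
      ⟨a3 0 (by omega), a3 1 (by omega), a2, a4⟩
    refine ⟨_, _, a1.seq (b1.seq ((Exec.const _ _ _).seq (Exec.add _ _ _ _))), ?_, ?_⟩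
    · change t ≤ (x.n + 0 + 1 + 2) ^ c at a5
      change t' ≤ (x.n + W + 1 + 2) ^ c' at b5
      have hWk : W ≤ (2 ^ (3 * x.graph.clusterVertexDeletionNumber)) ^
          (3 * x.graph.clusterVertexDeletionNumber) := by
        rw [hW, Inst.numGuesses_eq]
        have hd := x.dNum_toInst_le 0
        exact (Nat.pow_le_pow_left (Nat.pow_le_pow_right two_pos hd) _).trans
          (Nat.pow_le_pow_right (by positivity) hd)
      refine le_trans ?_ (Nat.mul_le_mul_right _
        (Nat.pow_le_pow_left (Nat.add_le_add_right hWk 3) _))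
      rw [← mul_pow]
      have hprod : (W + 3) * (x.n + 1) = W * x.n + W + 3 * x.n + 3 := by ring
      have hWn := Nat.zero_le (W * x.n)
      obtain ⟨a, ha⟩ : ∃ a, (W + 3) * (x.n + 1) = a + 2 :=
        Nat.exists_eq_add_of_le' (by omega)
      beta_reduce
      rw [ha]
      have t1 : (x.n + 0 + 1 + 2) ^ c ≤ (a + 2) ^ c := Nat.pow_le_pow_left (by omega) _
      have t2 : (x.n + W + 1 + 2) ^ c' ≤ (a + 2) ^ c' := Nat.pow_le_pow_left (by omega) _
      have t3 := pow_add_pow_le a c c'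
      have t4 := pow_add_pow_le a (c + c' + 1) 1
      have t5 : (a + 2) ^ 1 = a + 2 := pow_one _
      omega
    · have hq : @Ne ℕ q' e' := Nat.ne_of_lt h2'
      have : ∀ z, (State.setReg z 0 (z.reg q' + z.reg e')).reg 0 = z.reg q' + z.reg e' :=
        fun z => Function.update_self (0 : ℕ) _ z.reg
      rw [this]
      have e1 : (s'.setReg e' 0).reg q' = s'.reg q' := Function.update_of_ne hq _ _
      have e2 : (s'.setReg e' 0).reg e' = 0 := Function.update_self _ _ _
      beta_reduce
      rw [e1, e2, add_zero, x.vertexIntegrity_le_iff W]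
      exact Iff.trans b2 (Inst.accept_iff (x.isGraph_toInst W) rfl)
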